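/- Let $p$ be a prime and $r\ge 1$ an integer. Starting with a partition $\mu$ of $n$, repeatedly replace $p^r$ parts of the same size $m$ by $p^{r-1}$ parts of size $pm$, until arriving at a partition $\widetilde\mu$ of $n$ in which no part appears more than $p^r-1$ times (this process terminates, and $\widetilde\mu$ does not depend on the order of the replacements). Let $p(n)$ denote the number of partitions of $n$. There is an absolute constant $C>0$ such that, for all integers $n\ge 3$, all primes $p$ and all integers $r\ge 1$ with $$p^r\le 10^{-3}\,\frac{\log n}{(\log\log n)^2},$$ for all but at most $$C\,p(n)\exp\left(-n^{1/(20p^r)}\right)$$ partitions $\mu$ of $n$, the partition $\widetilde\mu$ contains at least $r$ distinct parts $m_1,\dots,m_r$, each appearing at least $p^{r-1}$ times in $\widetilde\mu$ and satisfying $$p^{r-1}m_j>\left(1+\frac{1}{6p^r}\right)\frac{\sqrt6}{2\pi}\sqrt n\,\log n\qquad(1\le j\le r).$$ -/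

import Mathlib

/-- `ν` arises from `μ` by replacing `p ^ r` parts of a common size `m` by `p ^ (r - 1)` parts of
size `p * m` (with `σ` the untouched parts). Used for `r ≥ 1` only. -/
def CombineStep (p r : ℕ) {n : ℕ} (μ ν : Nat.Partition n) : Prop :=
  ∃ (m : ℕ) (σ : Multiset ℕ),
    μ.parts = σ + Multiset.replicate (p ^ r) m ∧
    ν.parts = σ + Multiset.replicate (p ^ (r - 1)) (p * m)

/-- No part appears more than `p ^ r - 1` times. -/
def NoPartRepeated (p r : ℕ) {n : ℕ} (ν : Nat.Partition n) : Prop :=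
  ∀ m : ℕ, ν.parts.count m < p ^ r

/-- `ν` is a final result of repeatedly combining parts, starting from `μ`. -/
def IsFullCombination (p r : ℕ) {n : ℕ} (μ ν : Nat.Partition n) : Prop :=
  Relation.ReflTransGen (CombineStep p r) μ ν ∧ NoPartRepeated p r ν

theorem combineStep_exists {p r n : ℕ} (hp : p.Prime) (hr : 1 ≤ r) (μ : Nat.Partition n) (m : ℕ)
    (σ : Multiset ℕ) (h : μ.parts = σ + Multiset.replicate (p ^ r) m) :
    ∃ ν : Nat.Partition n, ν.parts = σ + Multiset.replicate (p ^ (r - 1)) (p * m) := by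
  have hpr : p ^ r = p ^ (r - 1) * p := by rw [← pow_succ, Nat.sub_add_cancel hr]
  have hm : 0 < m := by
    apply μ.parts_pos
    rw [h, Multiset.mem_add]
    exact Or.inr (Multiset.mem_replicate.2 ⟨(pow_pos hp.pos r).ne', rfl⟩)
  refine ⟨⟨σ + Multiset.replicate (p ^ (r - 1)) (p * m), ?_, ?_⟩, rfl⟩
  · intro i hi
    rcases Multiset.mem_add.1 hi with hi | hi
    · exact μ.parts_pos (by rw [h]; exact Multiset.mem_add.2 (Or.inl hi))
    · rw [Multiset.eq_of_mem_replicate hi]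
      exact Nat.mul_pos hp.pos hm
  · have hs := μ.parts_sum
    rw [h] at hs
    simp only [Multiset.sum_add, Multiset.sum_replicate, smul_eq_mul] at hs ⊢
    rw [← hs, hpr]
    ring

theorem combineStep_card_lt {p r n : ℕ} (hp : p.Prime) (hr : 1 ≤ r) {μ ν : Nat.Partition n}
    (h : CombineStep p r μ ν) : ν.parts.card < μ.parts.card := by
  obtain ⟨m, σ, h1, h2⟩ := h
  rw [h1, h2]
  simp only [Multiset.card_add, Multiset.card_replicate]
  have : p ^ (r - 1) < p ^ r := Nat.pow_lt_pow_right hp.one_lt (by omega)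
  omega

theorem noPartRepeated_iff {p r n : ℕ} (hp : p.Prime) (hr : 1 ≤ r) (μ : Nat.Partition n) :
    NoPartRepeated p r μ ↔ ∀ ν, ¬ CombineStep p r μ ν := by
  constructor
  · rintro h ν ⟨m, σ, h1, -⟩
    have := h m
    rw [h1, Multiset.count_add, Multiset.count_replicate_self] at this
    omega
  · intro h m
    by_contra! hm
    obtain ⟨σ, hσ⟩ := Multiset.le_iff_exists_add.1 (Multiset.le_count_iff_replicate_le.1 hm)
    rw [add_comm] at hσ
    obtain ⟨ν, hν⟩ := combineStep_exists hp hr μ m σ hσ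
    exact h ν ⟨m, σ, hσ, hν⟩

theorem exists_isFullCombination {p r n : ℕ} (hp : p.Prime) (hr : 1 ≤ r) (μ : Nat.Partition n) :
    ∃ ν, IsFullCombination p r μ ν := by
  induction hk : μ.parts.card using Nat.strong_induction_on generalizing μ with
  | _ k ih =>
    by_cases hμ : NoPartRepeated p r μ
    · exact ⟨μ, Relation.ReflTransGen.refl, hμ⟩
    · rw [noPartRepeated_iff hp hr] at hμ
      push Not at hμ
      obtain ⟨ν, hν⟩ := hμ
      obtain ⟨ρ, h1, h2⟩ := ih _ (hk ▸ combineStep_card_lt hp hr hν) ν rfl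
      exact ⟨ρ, Relation.ReflTransGen.head hν h1, h2⟩

theorem combineStep_diamond {p r n : ℕ} (hp : p.Prime) (hr : 1 ≤ r) {μ ν₁ ν₂ : Nat.Partition n}
    (h1 : CombineStep p r μ ν₁) (h2 : CombineStep p r μ ν₂) :
    ∃ ρ, Relation.ReflGen (CombineStep p r) ν₁ ρ ∧
      Relation.ReflTransGen (CombineStep p r) ν₂ ρ := by
  obtain ⟨m, σ, hμ, hν₁⟩ := h1
  obtain ⟨m', σ', hμ', hν₂⟩ := h2
  by_cases hmm : m = m'
  · subst hmm
    have hσ : σ = σ' := add_right_cancel (hμ.symm.trans hμ')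
    subst hσ
    have : ν₁ = ν₂ := Nat.Partition.ext (hν₁.trans hν₂.symm)
    subst this
    exact ⟨ν₁, Relation.ReflGen.refl, Relation.ReflTransGen.refl⟩
  · have hle : Multiset.replicate (p ^ r) m' ≤ σ := by
      rw [← Multiset.le_count_iff_replicate_le]
      have := congrArg (Multiset.count m') (hμ.symm.trans hμ')
      rw [Multiset.count_add, Multiset.count_add, Multiset.count_replicate_self,
        Multiset.count_replicate, if_neg hmm] at this
      omega
    obtain ⟨τ, hτ⟩ := Multiset.le_iff_exists_add.1 hle
    have hσ' : σ' = τ + Multiset.replicate (p ^ r) m := by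
      have := hμ.symm.trans hμ'
      rw [hτ] at this
      apply add_right_cancel (b := Multiset.replicate (p ^ r) m')
      rw [← this]
      abel
    have e1 : ν₁.parts = (τ + Multiset.replicate (p ^ (r - 1)) (p * m)) +
        Multiset.replicate (p ^ r) m' := by
      rw [hν₁, hτ]; abel
    have e2 : ν₂.parts = (τ + Multiset.replicate (p ^ (r - 1)) (p * m')) +
        Multiset.replicate (p ^ r) m := by
      rw [hν₂, hσ']; abel
    obtain ⟨ρ, hρ⟩ := combineStep_exists hp hr ν₁ m' _ e1
    refine ⟨ρ, Relation.ReflGen.single ⟨m', _, e1, hρ⟩,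
      Relation.ReflTransGen.single ⟨m, _, e2, ?_⟩⟩
    rw [hρ]; abel

/-- The process terminates in exactly one partition, whatever the order of the replacements. -/
theorem existsUnique_isFullCombination {p r n : ℕ} (hp : p.Prime) (hr : 1 ≤ r)
    (μ : Nat.Partition n) : ∃! ν, IsFullCombination p r μ ν := by
  obtain ⟨ν, hν⟩ := exists_isFullCombination hp hr μ
  refine ⟨ν, hν, fun ν' hν' => ?_⟩
  obtain ⟨ρ, h1, h2⟩ := Relation.church_rosser
    (fun _ _ _ h h' => combineStep_diamond hp hr h h') hν.1 hν'.1
  have key : ∀ {x : Nat.Partition n}, NoPartRepeated p r x →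
      Relation.ReflTransGen (CombineStep p r) x ρ → x = ρ := by
    intro x hx hxρ
    rcases Relation.ReflTransGen.cases_head hxρ with h | ⟨c, hc, -⟩
    · exact h
    · exact absurd hc ((noPartRepeated_iff hp hr x).1 hx c)
  rw [key hν.2 h1, key hν'.2 h2]

/-- The partition `μ̃`: the result of repeatedly replacing `p ^ r` equal parts `m` of `μ` by
`p ^ (r - 1)` parts `p * m` until no part appears more than `p ^ r - 1` times. -/
noncomputable def fullCombination {p r n : ℕ} (hp : p.Prime) (hr : 1 ≤ r)
    (μ : Nat.Partition n) : Nat.Partition n :=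
  (existsUnique_isFullCombination hp hr μ).choose

theorem fullCombination_spec {p r n : ℕ} (hp : p.Prime) (hr : 1 ≤ r) (μ : Nat.Partition n) :
    IsFullCombination p r μ (fullCombination hp hr μ) :=
  (existsUnique_isFullCombination hp hr μ).choose_spec.1

/-- `ν` contains at least `r` distinct parts `m`, each appearing at least `p ^ (r - 1)` times and
satisfying `p ^ (r - 1) * m > (1 + 1 / (6 p ^ r)) * (√6 / (2 π)) * √n * log n`. -/
def HasManyLargeParts (p r : ℕ) {n : ℕ} (ν : Nat.Partition n) : Prop :=
  ∃ S : Finset ℕ, S.card = r ∧ ∀ m ∈ S,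
    p ^ (r - 1) ≤ ν.parts.count m ∧
    (1 + 1 / (6 * (p : ℝ) ^ r)) * (Real.sqrt 6 / (2 * Real.pi)) * Real.sqrt n * Real.log n
      < (p : ℝ) ^ (r - 1) * (m : ℝ)

/-! Split the part sizes into chains `a * p ^ k` with `p ∤ a`, and count multiplicities in blocks of
`p ^ (r - 1)`. A replacement turns `p` blocks at level `k` into one block at level `k + 1`, so the
weight `∑ p ^ k * blocks` of a chain is invariant. In the final partition every level has fewer than
`p` blocks, so these are base-`p` digits of the weight: weight at least `p ^ K` forces a nonzero
digit at some level `k ≥ K`, that is, `p ^ (r - 1)` copies of a part at least `a * p ^ K`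
(`exists_large_count`). It therefore suffices to find, in the original partition, `r` chains of
weight at least `p ^ K` whose `a` lies just above the required threshold.

Such chains are found in the Boltzmann model with `x = π / √(6n)`, where multiplicities are
independent and geometric. Write `L = log n`, `N = p ^ r`. The weight may be spread over levels `1,
…, J` in many ways, all with the same probability, and this entropy gives a chain probability of
about `exp (-l) * (2 * N) ^ J` with `l ≈ L / 2 + L / (12 * N)` and `J ≈ L / (4 * N)`
(`real_good_ge`, `real_good_ge_of_le`). About `√n / p ^ J` values of `a` are available, up to powers
of `L`. As `p ≤ N`, the expected number of good chains is at least about `2 ^ J * exp (-L / (12 *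
N))`, hence `exp (0.0899 * L / N)` up to powers of `L`. Chains are independent, so failure is
exponentially unlikely in this number.

Every partition of `n` has the same Boltzmann probability, at least `exp (-2π√n / √6)`. Together
with a lower bound for the partition function that loses only a power of `n` (`exists_card_ge`),
this transfers the estimate to the uniform count. The power of `n` is absorbed because `L / N ≥ 1000
* (log L) ^ 2`. -/

/-! ### The chain weight as an invariant of the replacements -/

/-- The base-`p` weight carried by the multiplicities of the parts `a * p ^ k`, counted in blocks
of `p ^ (r - 1)`. -/
def chainWeight (p r a : ℕ) {n : ℕ} (μ : Nat.Partition n) : ℕ :=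
  ∑ k ∈ Finset.range (n + 1), p ^ k * (μ.parts.count (a * p ^ k) / p ^ (r - 1))

theorem Nat.Partition.count_eq_zero_of_lt {n m : ℕ} (μ : Nat.Partition n) (h : n < m) :
    μ.parts.count m = 0 := by
  rw [Multiset.count_eq_zero]
  intro hm
  have h1 := Multiset.single_le_sum (fun _ _ => Nat.zero_le _) m hm
  rw [μ.parts_sum] at h1
  omega

theorem pos_of_not_dvd {p a : ℕ} (ha : ¬ p ∣ a) : 0 < a :=
  Nat.pos_of_ne_zero fun h => ha (h ▸ dvd_zero p)

/-- The step removes `p` blocks of weight `p ^ k` and adds one of weight `p ^ (k + 1)`; block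
quotients see this exactly because whole blocks are moved. -/
theorem chainWeight_eq_of_combineStep {p r a n : ℕ} (hp : p.Prime) (hr : 1 ≤ r) (ha : ¬ p ∣ a)
    {μ ν : Nat.Partition n} (h : CombineStep p r μ ν) :
    chainWeight p r a μ = chainWeight p r a ν := by
  obtain ⟨m, σ, h1, h2⟩ := h
  have hpr : p ^ r = p * p ^ (r - 1) := by rw [← pow_succ', Nat.sub_add_cancel hr]
  have hpos : 0 < p ^ (r - 1) := pow_pos hp.pos _
  have e1 : ∀ k, p ^ k * (μ.parts.count (a * p ^ k) / p ^ (r - 1)) =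
      p ^ k * (σ.count (a * p ^ k) / p ^ (r - 1)) +
        (if m = a * p ^ k then p ^ (k + 1) else 0) := by
    intro k
    rw [h1, Multiset.count_add, Multiset.count_replicate]
    split_ifs with hm
    · rw [hpr, Nat.add_mul_div_right _ _ hpos]; ring
    · simp
  have e2 : ∀ k, p ^ k * (ν.parts.count (a * p ^ k) / p ^ (r - 1)) =
      p ^ k * (σ.count (a * p ^ k) / p ^ (r - 1)) +
        (if p * m = a * p ^ k then p ^ k else 0) := by
    intro k
    rw [h2, Multiset.count_add, Multiset.count_replicate]
    split_ifs with hm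
    · rw [Nat.add_div_right _ hpos]; ring
    · simp
  unfold chainWeight
  -- The two correction sums agree after shifting `k` by one. The unmatched ends vanish: `p * m = a`
  -- contradicts `p ∤ a`, and a part `a * p ^ n` would exceed `n`.
  rw [Finset.sum_congr rfl fun k _ => e1 k, Finset.sum_congr rfl fun k _ => e2 k,
    Finset.sum_add_distrib, Finset.sum_add_distrib, add_right_inj,
    Finset.sum_range_succ, Finset.sum_range_succ', if_neg, if_neg]
  · simp only [add_zero]
    refine Finset.sum_congr rfl fun k _ => ?_
    have : (p * m = a * p ^ (k + 1)) ↔ m = a * p ^ k := by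
      rw [pow_succ', mul_left_comm]
      exact Nat.mul_right_inj hp.pos.ne'
    simp only [this]
  · rw [pow_zero, mul_one]
    exact fun h => ha ⟨m, h.symm⟩
  · intro hm
    have hlt : n < a * p ^ n :=
      (Nat.lt_pow_self hp.one_lt).trans_le (Nat.le_mul_of_pos_left _ (pos_of_not_dvd ha))
    have h0 := μ.count_eq_zero_of_lt (m := m) (by omega)
    rw [h1, Multiset.count_add, Multiset.count_replicate_self] at h0
    have := pow_pos hp.pos r
    omega

theorem chainWeight_fullCombination {p r a n : ℕ} (hp : p.Prime) (hr : 1 ≤ r) (ha : ¬ p ∣ a)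
    (μ : Nat.Partition n) :
    chainWeight p r a (fullCombination hp hr μ) = chainWeight p r a μ := by
  have h := (fullCombination_spec hp hr μ).1
  generalize fullCombination hp hr μ = ν at h
  induction h with
  | refl => rfl
  | tail _ hs ih => rw [← ih, chainWeight_eq_of_combineStep hp hr ha hs]

theorem sum_pow_mul_lt {p : ℕ} (hp : 0 < p) (f : ℕ → ℕ) (hf : ∀ k, f k < p) (K : ℕ) :
    ∑ k ∈ Finset.range K, p ^ k * f k < p ^ K := by
  induction K with
  | zero => simp
  | succ K ih =>
    rw [Finset.sum_range_succ, pow_succ]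
    have := Nat.mul_le_mul_left (p ^ K) (Nat.le_sub_one_of_lt (hf K))
    have h2 : p ^ K * (p - 1) + p ^ K = p ^ K * p := by
      rw [← Nat.mul_succ, Nat.succ_eq_add_one, Nat.sub_add_cancel hp]
    omega

/-- After full combination the block counts are base-`p` digits, and digits below level `K` alone
sum to less than `p ^ K`. -/
theorem exists_large_count {p r a n K : ℕ} (hp : p.Prime) (hr : 1 ≤ r) (ha : ¬ p ∣ a)
    (μ : Nat.Partition n) (h : p ^ K ≤ chainWeight p r a μ) :
    ∃ k, K ≤ k ∧ p ^ (r - 1) ≤ (fullCombination hp hr μ).parts.count (a * p ^ k) := by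
  rw [← chainWeight_fullCombination hp hr ha μ] at h
  by_contra! hc
  have hspec := (fullCombination_spec hp hr μ).2
  set ν := fullCombination hp hr μ
  have hpos : 0 < p ^ (r - 1) := pow_pos hp.pos _
  have hlt := sum_pow_mul_lt hp.pos (fun k => ν.parts.count (a * p ^ k) / p ^ (r - 1))
    (fun k => by
      rw [Nat.div_lt_iff_lt_mul hpos, ← pow_succ', Nat.sub_add_cancel hr]
      exact hspec _) K
  refine absurd h (not_le.2 (lt_of_le_of_lt ?_ hlt))
  unfold chainWeight
  rw [← Finset.sum_filter_add_sum_filter_not _ (· < K)]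
  rw [Finset.sum_eq_zero (s := Finset.filter (fun k => ¬ k < K) _), add_zero]
  · refine Finset.sum_le_sum_of_subset fun k hk => ?_
    simpa using (Finset.mem_filter.1 hk).2
  · intro k hk
    rw [Nat.div_eq_of_lt (hc k (not_lt.1 (Finset.mem_filter.1 hk).2)), mul_zero]

theorem eq_of_mul_pow_eq {p a b i j : ℕ} (hp : p.Prime) (ha : ¬ p ∣ a) (hb : ¬ p ∣ b)
    (h : a * p ^ i = b * p ^ j) : a = b ∧ i = j := by
  wlog hij : i ≤ j generalizing a b i j
  · obtain ⟨h1, h2⟩ := this hb ha h.symm (by omega)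
    exact ⟨h1.symm, h2.symm⟩
  obtain ⟨d, rfl⟩ := Nat.exists_eq_add_of_le hij
  rw [pow_add, mul_left_comm, mul_comm, Nat.mul_right_inj (pow_pos hp.pos i).ne'] at h
  rcases Nat.eq_zero_or_pos d with rfl | hd
  · simpa using h
  · exact absurd (h ▸ Dvd.dvd.mul_left (dvd_pow_self p hd.ne') b) ha

/-- The levels reached in different chains are not controlled, but different chains are disjoint, so
the parts found are distinct anyway. -/
theorem hasManyLargeParts_of_chainWeight {p r n K : ℕ} (hp : p.Prime) (hr : 1 ≤ r)
    (μ : Nat.Partition n) (a : Fin r → ℕ) (hinj : Function.Injective a)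
    (ha : ∀ g, ¬ p ∣ a g) (hw : ∀ g, p ^ K ≤ chainWeight p r (a g) μ)
    (hT : ∀ g, (1 + 1 / (6 * (p : ℝ) ^ r)) * (Real.sqrt 6 / (2 * Real.pi)) * Real.sqrt n *
      Real.log n < (p : ℝ) ^ (r - 1) * ((a g * p ^ K : ℕ) : ℝ)) :
    HasManyLargeParts p r (fullCombination hp hr μ) := by
  choose k hk hc using fun g => exists_large_count hp hr (ha g) μ (hw g)
  refine ⟨Finset.univ.image fun g => a g * p ^ k g, ?_, ?_⟩
  · rw [Finset.card_image_of_injective, Finset.card_fin]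
    exact fun g g' h => hinj (eq_of_mul_pow_eq hp (ha g) (ha g') h).1
  · intro m hm
    obtain ⟨g, -, rfl⟩ := Finset.mem_image.1 hm
    refine ⟨hc g, (hT g).trans_le ?_⟩
    gcongr
    exacts [hp.one_lt.le, hk g]

/-! ### The Boltzmann model and the probability of a heavy chain -/

open MeasureTheory ProbabilityTheory

/-- A family of independent random multiplicities; the one of the part `m ≥ 1` is geometric with
ratio `exp (-x * m)`. -/
structure IsBoltzmannFamily {Ω : Type*} [MeasurableSpace Ω] (P : Measure Ω) (x : ℝ)
    (X : ℕ → Ω → ℕ) : Prop where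
  indep : iIndepFun X P
  meas : ∀ m, Measurable (X m)
  tail : ∀ m, 1 ≤ m → ∀ b : ℕ, P.real {ω | b ≤ X m ω} = Real.exp (-(x * m * b))

theorem geometricMeasure_real_tail {p : unitInterval} (hp : p ≠ 0) (b : ℕ) :
    (geometricMeasure p).real {j | b ≤ j} = (1 - p : ℝ) ^ b := by
  have h1 : {j : ℕ | b ≤ j} = ((Finset.range b : Finset ℕ) : Set ℕ)ᶜ := by
    ext j; simp
  rw [h1, probReal_compl_eq_one_sub (Finset.measurableSet _), ← sum_measureReal_singleton]
  simp only [geometricMeasure_real_singleton hp]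
  have hp0 : (p : ℝ) ≠ 0 := fun h => hp (Subtype.ext h)
  rw [← Finset.sum_mul, geom_sum_eq (by simpa using hp0), show (1 - p : ℝ) - 1 = -p by ring]
  field_simp
  ring

/-- The success probability `1 - exp (-x * m)`. -/
noncomputable def boltzmannParam (x : ℝ) (hx : 0 < x) (m : ℕ) : unitInterval :=
  ⟨1 - Real.exp (-(x * m)), by
    have h1 : Real.exp (-(x * m)) ≤ 1 := Real.exp_le_one_iff.2 (by simp; positivity)
    have h2 := Real.exp_pos (-(x * m))
    constructor <;> linarith⟩

theorem isBoltzmannFamily_infinitePi (x : ℝ) (hx : 0 < x) :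
    IsBoltzmannFamily (Measure.infinitePi fun m => geometricMeasure (boltzmannParam x hx m)) x
      (fun m ω => ω m) where
  indep := iIndepFun_infinitePi (X := fun _ => id) (fun _ => measurable_id)
  meas := measurable_pi_apply
  tail := by
    intro m hm b
    have hm' : (0 : ℝ) < m := by exact_mod_cast hm
    have h0 : boltzmannParam x hx m ≠ 0 := by
      intro h
      have h1 : 1 - Real.exp (-(x * m)) = 0 := congrArg Subtype.val h
      have h2 : Real.exp (-(x * m)) < 1 := Real.exp_lt_one_iff.2 (by simp; positivity)
      linarith
    have h1 := (measurePreserving_eval_infinitePi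
      (fun m => geometricMeasure (boltzmannParam x hx m)) m).measureReal_preimage
      (s := {j | b ≤ j}) (MeasurableSet.of_discrete.nullMeasurableSet)
    refine h1.trans ?_
    rw [geometricMeasure_real_tail h0]
    simp only [boltzmannParam, sub_sub_cancel]
    rw [← Real.exp_nat_mul]
    ring_nf

namespace IsBoltzmannFamily

variable {Ω : Type*} [MeasurableSpace Ω] {P : Measure Ω} {x : ℝ} {X : ℕ → Ω → ℕ}

theorem real_window [IsProbabilityMeasure P] (h : IsBoltzmannFamily P x X) {m s : ℕ} (hm : 1 ≤ m)
    (hs : 0 < s) (b : ℕ) :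
    P.real {ω | X m ω / s = b} =
      Real.exp (-(x * m * s) * b) * (1 - Real.exp (-(x * m * s))) := by
  have h1 : {ω | X m ω / s = b} = {ω | s * b ≤ X m ω} \ {ω | s * (b + 1) ≤ X m ω} := by
    ext ω
    simp only [Set.mem_ofPred_eq, Set.mem_sdiff]
    rw [Nat.div_eq_iff hs, mul_add, mul_one, mul_comm s b]
    omega
  rw [h1, measureReal_sdiff, h.tail m hm, h.tail m hm, mul_sub, mul_one, ← Real.exp_add]
  · push_cast; ring_nf
  · intro ω
    simp only [Set.mem_ofPred_eq, mul_add]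
    omega
  · exact measurableSet_le measurable_const (h.meas m)

theorem real_eq [IsProbabilityMeasure P] (h : IsBoltzmannFamily P x X) {m : ℕ} (hm : 1 ≤ m)
    (b : ℕ) :
    P.real {ω | X m ω = b} = Real.exp (-(x * (m * b : ℕ))) * (1 - Real.exp (-(x * m))) := by
  have := h.real_window hm one_pos b
  simp only [Nat.div_one, Nat.cast_one, mul_one] at this
  rw [this]
  push_cast; ring_nf

/-- The event that the chain of `a` carries at least the weight `D`. -/
def good (X : ℕ → Ω → ℕ) (p s J D a : ℕ) : Set Ω :=
  {ω | D ≤ ∑ k ∈ Finset.range (J + 1), p ^ k * (X (a * p ^ k) ω / s)}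

theorem measurableSet_good (h : IsBoltzmannFamily P x X) (p s J D a : ℕ) :
    MeasurableSet (good X p s J D a) := by
  refine measurableSet_le measurable_const (Finset.measurable_sum _ fun k _ => ?_)
  exact (measurable_from_top (f := fun j : ℕ => p ^ k * (j / s))).comp (h.meas _)

/-- Prescribe block counts `β k ≤ b k` at levels `1, …, J` and let level `0` supply at least the
remaining weight. These events are disjoint and equally likely, so their number `∏ (b k + 1)`
multiplies the probability of one of them. -/
theorem real_good_ge [IsProbabilityMeasure P] (h : IsBoltzmannFamily P x X) {p s J D a : ℕ}
    (hp : 1 < p) (hs : 0 < s) (ha : 0 < a) (b : Fin J → ℕ)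
    (hb : ∑ k, p ^ (k.val + 1) * b k ≤ D) :
    Real.exp (-(x * a * s) * D) *
      ∏ k : Fin J, (1 - Real.exp (-(x * a * s) * p ^ (k.val + 1))) * ((b k : ℝ) + 1) ≤
      P.real (good X p s J D a) := by
  have hap : ∀ k, 1 ≤ a * p ^ k := fun k => Nat.mul_pos ha (pow_pos (by omega) k)
  set T : Finset (Fin J → ℕ) := Fintype.piFinset fun k => Finset.range (b k + 1) with hT
  let A : (Fin J → ℕ) → Fin (J + 1) → Set ℕ := fun β =>
    Fin.cons {j | D - ∑ k, p ^ (k.val + 1) * β k ≤ j / s} (fun k => {j | j / s = β k})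
  let E : (Fin J → ℕ) → Set Ω := fun β => ⋂ k : Fin (J + 1), X (a * p ^ k.val) ⁻¹' A β k
  have hβ : ∀ β ∈ T, ∑ k, p ^ (k.val + 1) * β k ≤ D := by
    intro β hβ
    refine le_trans (Finset.sum_le_sum fun k _ => Nat.mul_le_mul_left _ ?_) hb
    have := Finset.mem_range.1 (Fintype.mem_piFinset.1 hβ k)
    omega
  have hmem : ∀ β ω, ω ∈ E β ↔ D - ∑ k, p ^ (k.val + 1) * β k ≤ X a ω / s ∧
      ∀ k : Fin J, X (a * p ^ (k.val + 1)) ω / s = β k := by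
    intro β ω
    simp only [E, A, Set.mem_iInter, Fin.forall_fin_succ]
    simp
  have hEmeas : ∀ β, MeasurableSet (E β) := fun β =>
    MeasurableSet.iInter fun k => h.meas _ MeasurableSet.of_discrete
  -- A block at level `k` costs the same exponential factor as the `p ^ k` blocks it saves at level
  -- `0`, so `β` cancels.
  have hEP : ∀ β ∈ T, P.real (E β) = Real.exp (-(x * a * s) * D) *
      ∏ k : Fin J, (1 - Real.exp (-(x * a * s) * p ^ (k.val + 1))) := by
    intro β hβT
    have hinj : Function.Injective fun k : Fin (J + 1) => a * p ^ k.val := by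
      intro i j hij
      exact Fin.ext (Nat.pow_right_injective hp (Nat.eq_of_mul_eq_mul_left ha hij))
    have h1 := (h.indep.precomp hinj).measure_inter_preimage_eq_mul Finset.univ
      (sets := A β) (fun _ _ => MeasurableSet.of_discrete)
    simp only [Finset.mem_univ, Set.iInter_true] at h1
    have h2 : P.real (E β) = ∏ k : Fin (J + 1), P.real (X (a * p ^ k.val) ⁻¹' A β k) := by
      simp only [measureReal_def, ← ENNReal.toReal_prod]
      exact congrArg _ h1
    rw [h2, Fin.prod_univ_succ]
    have h3 : P.real (X (a * p ^ (0 : Fin (J + 1)).val) ⁻¹' A β 0) =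
        Real.exp (-(x * a * s) * (D - ∑ k, (p : ℝ) ^ (k.val + 1) * β k)) := by
      have : X (a * p ^ (0 : Fin (J + 1)).val) ⁻¹' A β 0 =
          {ω | s * (D - ∑ k, p ^ (k.val + 1) * β k) ≤ X a ω} := by
        ext ω
        simp [A, Nat.le_div_iff_mul_le hs, mul_comm]
      rw [this, h.tail a ha]
      push_cast [Nat.cast_sub (hβ β hβT)]
      ring_nf
    have h4 : ∀ k : Fin J, P.real (X (a * p ^ k.succ.val) ⁻¹' A β k.succ) =
        Real.exp (-(x * a * s) * ((p : ℝ) ^ (k.val + 1) * β k)) *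
          (1 - Real.exp (-(x * a * s) * p ^ (k.val + 1))) := by
      intro k
      have : X (a * p ^ k.succ.val) ⁻¹' A β k.succ =
          {ω | X (a * p ^ (k.val + 1)) ω / s = β k} := by
        ext ω
        simp [A]
      rw [this, h.real_window (hap _) hs]
      push_cast
      ring_nf
    rw [h3, Finset.prod_congr rfl fun k _ => h4 k, Finset.prod_mul_distrib, ← Real.exp_sum,
      ← mul_assoc, ← Real.exp_add, ← Finset.mul_sum]
    ring_nf
  have hdisj : (T : Set (Fin J → ℕ)).PairwiseDisjoint E := by
    intro β _ β' _ hne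
    refine Set.disjoint_left.2 fun ω hω hω' => hne (funext fun k => ?_)
    rw [← ((hmem β ω).1 hω).2 k, ← ((hmem β' ω).1 hω').2 k]
  have hsub : (⋃ β ∈ T, E β) ⊆ good X p s J D a := by
    intro ω hω
    simp only [Set.mem_iUnion] at hω
    obtain ⟨β, hβT, hω⟩ := hω
    obtain ⟨h0, h1⟩ := (hmem β ω).1 hω
    simp only [good, Set.mem_ofPred_eq]
    rw [Finset.sum_range_succ', Finset.sum_range, Finset.sum_congr rfl fun k _ => by rw [h1 k]]
    simp only [pow_zero, mul_one, one_mul]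
    omega
  refine le_trans (le_of_eq ?_) (measureReal_mono hsub)
  rw [measureReal_biUnion_finset hdisj fun β _ => hEmeas β, Finset.sum_congr rfl hEP,
    Finset.sum_const, Fintype.card_piFinset, Finset.prod_mul_distrib, nsmul_eq_mul]
  push_cast [Finset.card_range]
  ring

/-- Chains of distinct `a` prime to `p` involve disjoint sets of variables, so the failures are
independent and `1 - ρ ≤ exp (-ρ)` applies to each. -/
theorem real_iInter_compl_good_le [IsProbabilityMeasure P] (h : IsBoltzmannFamily P x X)
    {p s J D : ℕ} (hp : p.Prime) {ρ : ℝ} (G : Finset ℕ) (hG : ∀ a ∈ G, ¬ p ∣ a)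
    (hρ : ∀ a ∈ G, ρ ≤ P.real (good X p s J D a)) :
    P.real (⋂ a ∈ G, (good X p s J D a)ᶜ) ≤ Real.exp (-(ρ * G.card)) := by
  classical
  induction G using Finset.induction_on with
  | empty => simp
  | insert a G haG ih =>
    have ih := ih (fun b hb => hG b (Finset.mem_insert_of_mem hb))
      (fun b hb => hρ b (Finset.mem_insert_of_mem hb))
    let chain : ℕ → Finset ℕ := fun b => (Finset.range (J + 1)).image fun k => b * p ^ k
    have hmemc : ∀ b k, k ∈ Finset.range (J + 1) → b * p ^ k ∈ chain b := fun b k hk =>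
      Finset.mem_image_of_mem _ hk
    have hdisj : Disjoint (chain a) (G.biUnion chain) := by
      rw [Finset.disjoint_left]
      intro m hm hm'
      obtain ⟨b, hb, hm'⟩ := Finset.mem_biUnion.1 hm'
      obtain ⟨i, -, hi⟩ := Finset.mem_image.1 hm
      obtain ⟨j, -, hj⟩ := Finset.mem_image.1 hm'
      have := (eq_of_mul_pow_eq hp (hG a (Finset.mem_insert_self _ _))
        (hG b (Finset.mem_insert_of_mem hb)) (hi.trans hj.symm)).1
      exact haG (this ▸ hb)
    have hind := h.indep.indepFun_finset _ _ hdisj h.meas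
    -- The failure event in terms of the coordinates in `S` only; the default `0` is never reached
    -- once `S` contains the chain of `b`.
    let ev (S : Finset ℕ) (b : ℕ) : Set (S → ℕ) :=
      {y | ¬ D ≤ ∑ k ∈ Finset.range (J + 1),
        p ^ k * ((if hk : b * p ^ k ∈ S then y ⟨b * p ^ k, hk⟩ else 0) / s)}
    have hev : ∀ (S : Finset ℕ) b, chain b ⊆ S → (good X p s J D b)ᶜ =
        (fun ω (i : S) => X i ω) ⁻¹' ev S b := by
      intro S b hb
      ext ω
      simp only [good, ev, Set.mem_compl_iff, Set.mem_ofPred_eq, Set.mem_preimage]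
      have : ∀ k ∈ Finset.range (J + 1), p ^ k * (X (b * p ^ k) ω / s) =
          p ^ k * ((if b * p ^ k ∈ S then X (b * p ^ k) ω else 0) / s) :=
        fun k hk => by rw [if_pos (hb (hmemc b k hk))]
      rw [Finset.sum_congr rfl this]
      rfl
    have e1 := hev (chain a) a subset_rfl
    have e2 : (⋂ b ∈ G, (good X p s J D b)ᶜ) = (fun ω (i : G.biUnion chain) => X i ω) ⁻¹'
        ⋂ b ∈ G, ev (G.biUnion chain) b := by
      rw [Set.preimage_iInter₂]
      exact Set.iInter₂_congr fun b hb => hev _ b (Finset.subset_biUnion_of_mem chain hb)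
    have hmul := hind.measure_inter_preimage_eq_mul (ev (chain a) a)
      (⋂ b ∈ G, ev (G.biUnion chain) b) MeasurableSet.of_discrete MeasurableSet.of_discrete
    rw [← e1, ← e2] at hmul
    rw [Finset.set_biInter_insert, measureReal_def, hmul, ENNReal.toReal_mul, ← measureReal_def,
      ← measureReal_def, Finset.card_insert_of_notMem haG,
      probReal_compl_eq_one_sub (h.measurableSet_good ..)]
    have h1 : 1 - P.real (good X p s J D a) ≤ Real.exp (-ρ) := by
      have := hρ a (Finset.mem_insert_self _ _)
      have := Real.add_one_le_exp (-ρ)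
      linarith
    calc _ ≤ Real.exp (-ρ) * Real.exp (-(ρ * G.card)) := by gcongr
      _ = _ := by rw [← Real.exp_add]; push_cast; ring_nf

/-- The probability of the multiplicities of a partition of `n` depends only on `n`, since the
exponents add up to `x * n`; counting is thus bounded by probability, without conditioning. -/
theorem ncard_mul_le [IsProbabilityMeasure P] (h : IsBoltzmannFamily P x X) {n : ℕ}
    (B : Set (Nat.Partition n)) (E : Set Ω)
    (hBE : ∀ μ ∈ B, ∀ ω, (∀ m ∈ Finset.Icc 1 n, X m ω = μ.parts.count m) → ω ∈ E) :
    (B.ncard : ℝ) * (Real.exp (-(x * n)) * ∏ m ∈ Finset.Icc 1 n, (1 - Real.exp (-(x * m)))) ≤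
      P.real E := by
  classical
  let A : Nat.Partition n → Set Ω := fun μ =>
    ⋂ m ∈ Finset.Icc 1 n, X m ⁻¹' {μ.parts.count m}
  have hA : ∀ μ, P.real (A μ) =
      Real.exp (-(x * n)) * ∏ m ∈ Finset.Icc 1 n, (1 - Real.exp (-(x * m))) := by
    intro μ
    have h1 := h.indep.measure_inter_preimage_eq_mul (Finset.Icc 1 n)
      (sets := fun m => {μ.parts.count m}) (fun _ _ => MeasurableSet.of_discrete)
    rw [measureReal_def, h1, ENNReal.toReal_prod]
    have hsum : ∑ m ∈ Finset.Icc 1 n, m * μ.parts.count m = n := by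
      conv_rhs => rw [← μ.parts_sum]
      rw [Finset.sum_multiset_count_of_subset μ.parts (Finset.Icc 1 n)]
      · exact Finset.sum_congr rfl fun m _ => by rw [smul_eq_mul, mul_comm]
      · intro m hm
        rw [Multiset.mem_toFinset] at hm
        rw [Finset.mem_Icc]
        refine ⟨μ.parts_pos hm, ?_⟩
        by_contra! hlt
        exact Multiset.count_ne_zero.2 hm (μ.count_eq_zero_of_lt hlt)
    have hexp : Real.exp (-(x * n)) =
        ∏ m ∈ Finset.Icc 1 n, Real.exp (-(x * (m * μ.parts.count m : ℕ))) := by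
      rw [← Real.exp_sum, Finset.sum_neg_distrib, ← Finset.mul_sum, ← Nat.cast_sum, hsum]
    rw [hexp, ← Finset.prod_mul_distrib]
    refine Finset.prod_congr rfl fun m hm => ?_
    rw [← h.real_eq (Finset.mem_Icc.1 hm).1]
    rfl
  have hmeas : ∀ μ, MeasurableSet (A μ) := fun μ =>
    Finset.measurableSet_biInter _ fun m _ => h.meas m MeasurableSet.of_discrete
  have hmem : ∀ μ ω, ω ∈ A μ ↔ ∀ m ∈ Finset.Icc 1 n, X m ω = μ.parts.count m := by
    intro μ ω
    simp [A]
  have hdisj : (B.toFinset : Set (Nat.Partition n)).PairwiseDisjoint A := by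
    intro μ _ ν _ hne
    refine Set.disjoint_left.2 fun ω h1 h2 => hne ?_
    rw [hmem] at h1 h2
    ext m
    by_cases hm : m ∈ Finset.Icc 1 n
    · rw [← h1 m hm, ← h2 m hm]
    · rw [Finset.mem_Icc, not_and_or, not_le, not_le] at hm
      rcases hm with hm | hm
      · have hm0 : m = 0 := by omega
        have : ∀ ρ : Nat.Partition n, ρ.parts.count m = 0 := fun ρ =>
          Multiset.count_eq_zero.2 fun h => absurd (ρ.parts_pos h) (by omega)
        rw [this, this]
      · rw [μ.count_eq_zero_of_lt hm, ν.count_eq_zero_of_lt hm]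
  have hsub : (⋃ μ ∈ B.toFinset, A μ) ⊆ E := by
    intro ω hω
    simp only [Set.mem_iUnion] at hω
    obtain ⟨μ, hμ, hω⟩ := hω
    exact hBE μ (Set.mem_toFinset.1 hμ) ω ((hmem μ ω).1 hω)
  refine le_trans (le_of_eq ?_) (measureReal_mono hsub)
  rw [measureReal_biUnion_finset hdisj fun μ _ => hmeas μ, Finset.sum_congr rfl fun μ _ => hA μ,
    Finset.sum_const, nsmul_eq_mul, Set.ncard_eq_toFinset_card']

end IsBoltzmannFamily

/-! ### The normalising product of the model -/

theorem sum_exp_neg_mul_le {t : ℝ} (ht : 0 < t) (n : ℕ) :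
    ∑ m ∈ Finset.Icc 1 n, Real.exp (-(t * m)) ≤ 1 / t := by
  have hr : Real.exp (-t) < 1 := Real.exp_lt_one_iff.2 (by linarith)
  have h1 : ∑ m ∈ Finset.Icc 1 n, Real.exp (-(t * m)) =
      Real.exp (-t) * ∑ m ∈ Finset.range n, Real.exp (-t) ^ m := by
    rw [Finset.range_eq_Ico, ← Finset.sum_Ico_add_right_sub_eq (c := 1), Finset.mul_sum]
    refine Finset.sum_congr (by ext; simp) fun m hm => ?_
    rw [← pow_succ', Nat.sub_add_cancel (Finset.mem_Ico.1 hm).1, ← Real.exp_nat_mul]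
    ring_nf
  have h2 : (∑ m ∈ Finset.range n, Real.exp (-t) ^ m) ≤ 1 / (1 - Real.exp (-t)) := by
    rw [one_div]
    exact (tsum_geometric_of_lt_one (Real.exp_pos _).le hr) ▸
      (summable_geometric_of_lt_one (Real.exp_pos _).le hr).sum_le_tsum _
        (fun _ _ => by positivity)
  have h3 : 0 < 1 - Real.exp (-t) := by linarith
  rw [h1]
  calc _ ≤ Real.exp (-t) * (1 / (1 - Real.exp (-t))) := by gcongr
    _ ≤ 1 / t := by
      rw [mul_one_div, div_le_div_iff₀ h3 ht]
      have h4 := Real.add_one_le_exp t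
      have h5 : Real.exp (-t) * Real.exp t = 1 := by rw [← Real.exp_add]; simp
      nlinarith [Real.exp_pos (-t)]

/-- Expand `-log (1 - exp (-x * m))` as a power series and sum over `m` first: the term of order `k`
is at most `1 / (x * k ^ 2)`, and `ζ(2) = π ^ 2 / 6`. -/
theorem exp_neg_le_prod {x : ℝ} (hx : 0 < x) (n : ℕ) :
    Real.exp (-(Real.pi ^ 2 / (6 * x))) ≤
      ∏ m ∈ Finset.Icc 1 n, (1 - Real.exp (-(x * m))) := by
  have hlt : ∀ m ∈ Finset.Icc 1 n, Real.exp (-(x * m)) < 1 := fun m hm => by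
    have : (0 : ℝ) < m := by exact_mod_cast (Finset.mem_Icc.1 hm).1
    exact Real.exp_lt_one_iff.2 (by simp; positivity)
  have hpos : ∀ m ∈ Finset.Icc 1 n, 0 < 1 - Real.exp (-(x * m)) := fun m hm => by
    linarith [hlt m hm]
  rw [← Real.le_log_iff_exp_le (Finset.prod_pos hpos), Real.log_prod fun m hm => (hpos m hm).ne',
    neg_le, ← Finset.sum_neg_distrib]
  have h1 : HasSum (fun k : ℕ => ∑ m ∈ Finset.Icc 1 n, Real.exp (-(x * m)) ^ (k + 1) / (k + 1))
      (∑ m ∈ Finset.Icc 1 n, -Real.log (1 - Real.exp (-(x * m)))) :=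
    hasSum_sum fun m hm => Real.hasSum_pow_div_log_of_abs_lt_one
      (by rw [abs_of_pos (Real.exp_pos _)]; exact hlt m hm)
  have h2 : HasSum (fun k : ℕ => 1 / x * (1 / ((k + 1 : ℕ) : ℝ) ^ 2)) (1 / x * (Real.pi ^ 2 / 6)) := by
    have := (hasSum_nat_add_iff' 1).2 hasSum_zeta_two
    simpa using this.mul_left (1 / x)
  have h3 : 1 / x * (Real.pi ^ 2 / 6) = Real.pi ^ 2 / (6 * x) := by field_simp
  rw [← h3]
  refine hasSum_le (fun k => ?_) h1 h2
  rw [← Finset.sum_div]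
  have h4 := sum_exp_neg_mul_le (t := x * ((k + 1 : ℕ) : ℝ)) (by positivity) n
  have h5 : ∀ m : ℕ, Real.exp (-(x * m)) ^ (k + 1) =
      Real.exp (-(x * ((k + 1 : ℕ) : ℝ) * m)) := fun m => by
    rw [← Real.exp_nat_mul]; ring_nf
  rw [Finset.sum_congr rfl fun m _ => h5 m, div_le_iff₀ (by positivity)]
  refine h4.trans (le_of_eq ?_)
  push_cast
  field_simp

/-! ### A lower bound for the partition function, up to a power of `n` -/

namespace Nat.Partition

theorem card_le_card_count_ge {n k v : ℕ} (hv : 0 < v) (hkv : k * v ≤ n) :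
    Fintype.card (Nat.Partition (n - k * v)) ≤
      (Finset.univ.filter fun μ : Nat.Partition n => k ≤ μ.parts.count v).card := by
  rw [← Finset.card_univ]
  refine Finset.card_le_card_of_injOn
    (fun ν => ⟨ν.parts + Multiset.replicate k v, fun {i} hi => ?_, ?_⟩) ?_ ?_
  · rcases Multiset.mem_add.1 hi with hi | hi
    · exact ν.parts_pos hi
    · rw [Multiset.eq_of_mem_replicate hi]; exact hv
  · rw [Multiset.sum_add, ν.parts_sum, Multiset.sum_replicate, smul_eq_mul]
    omega
  · intro ν _
    simp
  · intro ν _ ν' _ h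
    have := congrArg Nat.Partition.parts h
    exact Nat.Partition.ext (add_right_cancel this)

/-- Double counting: adding `k` copies of `v` injects partitions of `n - k * v` into those of `n`
with at least `k` parts `v`, and for each partition the sum of `v` over such pairs `(k, v)` is at
most `n`. -/
theorem sum_mul_card_le (n K : ℕ) :
    ∑ k ∈ Finset.Icc 1 K, ∑ v ∈ (Finset.Icc 1 n).filter (fun v => k * v ≤ n),
      v * Fintype.card (Nat.Partition (n - k * v)) ≤ n * Fintype.card (Nat.Partition n) := by
  have key : ∀ μ : Nat.Partition n, ∑ k ∈ Finset.Icc 1 K, ∑ v ∈ Finset.Icc 1 n,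
      (if k ≤ μ.parts.count v then v else 0) ≤ n := by
    intro μ
    rw [Finset.sum_comm]
    have h1 : ∀ v ∈ Finset.Icc 1 n, ∑ k ∈ Finset.Icc 1 K,
        (if k ≤ μ.parts.count v then v else 0) ≤ μ.parts.count v • v := by
      intro v _
      rw [← Finset.sum_filter, Finset.sum_const, smul_eq_mul, smul_eq_mul]
      refine Nat.mul_le_mul_right _ ?_
      calc _ ≤ (Finset.Icc 1 (μ.parts.count v)).card := Finset.card_le_card fun k hk => by
            simp only [Finset.mem_filter, Finset.mem_Icc] at hk ⊢
            omega
        _ = _ := by simp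
    refine (Finset.sum_le_sum h1).trans (le_of_eq ?_)
    conv_rhs => rw [← μ.parts_sum]
    rw [Finset.sum_multiset_count_of_subset μ.parts (Finset.Icc 1 n)]
    intro m hm
    rw [Multiset.mem_toFinset] at hm
    rw [Finset.mem_Icc]
    refine ⟨μ.parts_pos hm, ?_⟩
    by_contra! hlt
    exact Multiset.count_ne_zero.2 hm (μ.count_eq_zero_of_lt hlt)
  calc _ ≤ ∑ k ∈ Finset.Icc 1 K, ∑ v ∈ Finset.Icc 1 n,
        ∑ μ : Nat.Partition n, (if k ≤ μ.parts.count v then v else 0) := by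
        refine Finset.sum_le_sum fun k _ => ?_
        refine le_trans (Finset.sum_le_sum fun v hv => ?_)
          (Finset.sum_le_sum_of_subset (Finset.filter_subset _ _))
        rw [Finset.mem_filter, Finset.mem_Icc] at hv
        rw [← Finset.sum_filter, Finset.sum_const, smul_eq_mul, mul_comm]
        exact Nat.mul_le_mul_right _ (card_le_card_count_ge hv.1.1 hv.2)
    _ = ∑ μ : Nat.Partition n, ∑ k ∈ Finset.Icc 1 K, ∑ v ∈ Finset.Icc 1 n,
        (if k ≤ μ.parts.count v then v else 0) := by
        exact (Finset.sum_congr rfl fun k _ => Finset.sum_comm).trans Finset.sum_comm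
    _ ≤ ∑ μ : Nat.Partition n, n := Finset.sum_le_sum fun μ _ => key μ
    _ = _ := by rw [Finset.sum_const, Finset.card_univ, smul_eq_mul, mul_comm]

end Nat.Partition

/-- The right side equals `1 / (2 * (cosh y - 1))`, and `cosh y ≤ exp (y ^ 2 / 2)`. -/
theorem inv_sq_sub_half_le {y : ℝ} (hy : 0 < y) (hy1 : y ≤ 1) :
    1 / y ^ 2 - 1 / 2 ≤ Real.exp (-y) / (1 - Real.exp (-y)) ^ 2 := by
  have h5 : Real.exp (-y) * Real.exp y = 1 := by rw [← Real.exp_add]; simp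
  have hlt : Real.exp (-y) < 1 := Real.exp_lt_one_iff.2 (by linarith)
  have h1 : (1 - Real.exp (-y)) ^ 2 = Real.exp (-y) * (2 * (Real.cosh y - 1)) := by
    rw [Real.cosh_eq]
    linear_combination -h5
  have h2 : Real.cosh y ≤ Real.exp (y ^ 2 / 2) := Real.cosh_le_exp_half_sq y
  have h3 := Real.abs_exp_sub_one_sub_id_le (x := y ^ 2 / 2)
    (by rw [abs_of_nonneg (by positivity)]; nlinarith)
  have h4 := (abs_le.1 h3).2
  have hc : 2 * (Real.cosh y - 1) ≤ y ^ 2 * (1 + y ^ 2 / 2) := by nlinarith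
  have hpos : 0 < (1 - Real.exp (-y)) ^ 2 := by
    have : 0 < 1 - Real.exp (-y) := by linarith
    positivity
  rw [le_div_iff₀ hpos, h1]
  have h6 : (1 / y ^ 2 - 1 / 2) * (y ^ 2 * (1 + y ^ 2 / 2)) ≤ 1 := by
    have : (1 / y ^ 2 - 1 / 2) * (y ^ 2 * (1 + y ^ 2 / 2)) = 1 - y ^ 4 / 4 := by
      field_simp; ring
    rw [this]
    have := pow_pos hy 4
    linarith
  have h7 : 0 ≤ 1 / y ^ 2 - 1 / 2 := by
    have : 1 ≤ 1 / y ^ 2 := by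
      rw [le_div_iff₀ (by positivity)]; nlinarith
    linarith
  calc (1 / y ^ 2 - 1 / 2) * (Real.exp (-y) * (2 * (Real.cosh y - 1)))
      = Real.exp (-y) * ((1 / y ^ 2 - 1 / 2) * (2 * (Real.cosh y - 1))) := by ring
    _ ≤ Real.exp (-y) * ((1 / y ^ 2 - 1 / 2) * (y ^ 2 * (1 + y ^ 2 / 2))) := by gcongr
    _ ≤ Real.exp (-y) * 1 := by gcongr
    _ = _ := mul_one _

/-- Lower bound for the sum over `v` of one row of the recurrence for the partition function. -/
theorem row_sum_ge {y b c : ℝ} (hy : 0 < y) (hy1 : y ≤ 1) (hb : 0 ≤ b) (hc : 0 ≤ c) :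
    ∃ s, HasSum (fun i : ℕ => ((i : ℝ) + 1) * Real.exp (-(y * (i + 1))) *
      (1 + b * (i + 1) - c * ((i : ℝ) + 1) ^ 2)) s ∧
      1 / y ^ 2 - 1 / 2 + b * (1 / (3 * y ^ 3)) - c * (96 / y ^ 4) ≤ s := by
  set q := Real.exp (-y) with hq
  have hq0 : 0 < q := Real.exp_pos _
  have hlt : q < 1 := Real.exp_lt_one_iff.2 (by linarith)
  have hnorm : ‖q‖ < 1 := by rwa [Real.norm_of_nonneg hq0.le]
  have h1 : 0 < 1 - q := by linarith
  have hqy : 1 - q ≤ y := by linarith [Real.add_one_le_exp (-y)]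
  have hqy2 : y / 2 ≤ 1 - q := by
    have h5 : q * Real.exp y = 1 := by rw [hq, ← Real.exp_add]; simp
    have := Real.add_one_le_exp y
    nlinarith
  have hq3 : 1 / 3 ≤ q := by
    have h6 : Real.exp (-1) ≤ q := Real.exp_le_exp.2 (by linarith)
    have h7 : Real.exp (-1) * Real.exp 1 = 1 := by rw [← Real.exp_add]; simp
    nlinarith [Real.exp_one_lt_d9, Real.exp_pos (-1)]
  have e : ∀ i : ℕ, Real.exp (-(y * (i + 1))) = q * q ^ i := fun i => by
    rw [hq, ← pow_succ', ← Real.exp_nat_mul]; push_cast; ring_nf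
  have s1 := hasSum_choose_mul_geometric_of_norm_lt_one 1 hnorm
  have s2 := hasSum_choose_mul_geometric_of_norm_lt_one 2 hnorm
  have s3 := hasSum_choose_mul_geometric_of_norm_lt_one 3 hnorm
  have c2 : ∀ i : ℕ, ((i + 2).choose 2 : ℝ) = (i + 2) * (i + 1) / 2 := fun i => by
    rw [Nat.cast_choose_two]; push_cast; ring
  have c3 : ∀ i : ℕ, ((i + 3).choose 3 : ℝ) = (i + 3) * (i + 2) * (i + 1) / 6 := fun i => by
    have h := Nat.add_one_mul_choose_eq (i + 2) 2
    have h' : ((i : ℝ) + 2 + 1) * ((i + 2).choose 2 : ℝ) = ((i + 3).choose 3 : ℝ) * (2 + 1) := by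
      exact_mod_cast h
    rw [c2] at h'
    linarith
  have sq' : Summable fun i : ℕ => ((i : ℝ) + 1) ^ 2 * q ^ i := by
    refine Summable.of_nonneg_of_le (fun i => by positivity) (fun i => ?_) (s2.summable.mul_left 2)
    rw [c2, ← mul_assoc]
    gcongr
    nlinarith [(Nat.cast_nonneg i : (0 : ℝ) ≤ i)]
  have cu' : Summable fun i : ℕ => ((i : ℝ) + 1) ^ 3 * q ^ i := by
    refine Summable.of_nonneg_of_le (fun i => by positivity) (fun i => ?_) (s3.summable.mul_left 6)
    rw [c3, ← mul_assoc]
    gcongr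
    have := (Nat.cast_nonneg i : (0 : ℝ) ≤ i)
    nlinarith [mul_nonneg this this]
  -- Squares and cubes are compared with binomial coefficients, whose generating series are powers
  -- of `1 / (1 - q)`. Then `q ≥ 1 / 3` gives the constant `1 / 3`, and `1 - q ≥ y / 2` gives `96 =
  -- 6 * 2 ^ 4`.
  have b2 : 1 / (1 - q) ^ 3 ≤ ∑' i : ℕ, ((i : ℝ) + 1) ^ 2 * q ^ i := by
    refine hasSum_le (fun i => ?_) s2 sq'.hasSum
    rw [c2]
    gcongr
    nlinarith [(Nat.cast_nonneg i : (0 : ℝ) ≤ i)]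
  have b3 : ∑' i : ℕ, ((i : ℝ) + 1) ^ 3 * q ^ i ≤ 6 * (1 / (1 - q) ^ 4) := by
    refine hasSum_le (fun i => ?_) cu'.hasSum (s3.mul_left 6)
    rw [c3, ← mul_assoc]
    gcongr
    have := (Nat.cast_nonneg i : (0 : ℝ) ≤ i)
    nlinarith [mul_nonneg this this]
  refine ⟨_, (((s1.mul_left q).add (sq'.hasSum.mul_left (q * b))).sub
    (cu'.hasSum.mul_left (q * c))).congr_fun fun i => ?_, ?_⟩
  · rw [e]; simp; ring
  · have t1 := inv_sq_sub_half_le hy hy1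
    have t2 : b * (1 / (3 * y ^ 3)) ≤ q * b * ∑' i : ℕ, ((i : ℝ) + 1) ^ 2 * q ^ i := by
      calc b * (1 / (3 * y ^ 3)) = 1 / 3 * b * (1 / y ^ 3) := by field_simp
        _ ≤ q * b * (1 / (1 - q) ^ 3) := by gcongr
        _ ≤ _ := by gcongr
    have t3 : q * c * ∑' i : ℕ, ((i : ℝ) + 1) ^ 3 * q ^ i ≤ c * (96 / y ^ 4) := by
      calc _ ≤ q * c * (6 * (1 / (1 - q) ^ 4)) := by gcongr
        _ ≤ 1 * c * (6 * (1 / (y / 2) ^ 4)) := by gcongr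
        _ = _ := by field_simp; ring
    have t4 : q * (1 / (1 - q) ^ (1 + 1)) = q / (1 - q) ^ 2 := by rw [mul_one_div]
    rw [t4]
    linarith

namespace Nat.Partition

/-- The comparison function for the lower bound on the number of partitions. -/
noncomputable def lowerModel (m : ℕ) : ℝ :=
  Real.exp (2 * Real.pi / Real.sqrt 6 * Real.sqrt m) / (m : ℝ) ^ 600

theorem sqrt_one_sub_ge {t : ℝ} (ht0 : 0 ≤ t) (ht : t < 1) :
    1 - t / 2 - t ^ 2 / 2 ≤ Real.sqrt (1 - t) := by
  apply Real.le_sqrt_of_sq_le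
  have h : (1 - t / 2 - t ^ 2 / 2) ^ 2 =
      (1 - t) * (1 - (3 * t ^ 2 / 4 + t ^ 3 / 4)) := by ring
  rw [h]
  have : 0 ≤ 3 * t ^ 2 / 4 + t ^ 3 / 4 := by positivity
  nlinarith

/-- The denominator `m ^ 600` yields the linear gain `600 * j / n`, the concavity of the square root
the quadratic loss `x * j ^ 2 / n`. -/
theorem lowerModel_sub_ge {n j : ℕ} {x : ℝ} (hn : 0 < n)
    (hx : x = Real.pi / (Real.sqrt 6 * Real.sqrt n)) (hbig : 601 ≤ x * n) (hj : 0 < j) :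
    lowerModel n * (Real.exp (-(x * j)) * (1 + 600 / n * j - x / n * (j : ℝ) ^ 2)) ≤
      if j ≤ n then lowerModel (n - j) else 0 := by
  have hn' : (0 : ℝ) < n := by exact_mod_cast hn
  have hj' : (0 : ℝ) < j := by exact_mod_cast hj
  have hA : 0 < lowerModel n := by unfold lowerModel; positivity
  have hx0 : 0 < x := by rw [hx]; have := Real.pi_pos; positivity
  rcases lt_or_ge j n with hjn | hjn
  · rw [if_pos hjn.le]
    have hjn' : (j : ℝ) < n := by exact_mod_cast hjn
    set t : ℝ := j / n with ht
    have ht0 : 0 < t := by positivity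
    have ht1 : t < 1 := by rw [ht, div_lt_one hn']; exact hjn'
    have hsub : ((n - j : ℕ) : ℝ) = n * (1 - t) := by
      rw [Nat.cast_sub hjn.le, ht]; field_simp
    have hsq : Real.sqrt n ^ 2 = n := Real.sq_sqrt hn'.le
    have hsn : 0 < Real.sqrt n := Real.sqrt_pos.2 hn'
    have hexp : x * j + x / n * (j : ℝ) ^ 2 =
        2 * Real.pi / Real.sqrt 6 * Real.sqrt n * (t / 2 + t ^ 2 / 2) := by
      have h6 : Real.sqrt 6 ≠ 0 := by positivity
      have hjt : (j : ℝ) = t * n := by rw [ht]; field_simp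
      rw [hx, hjt]
      field_simp
      rw [hsq]
    have h1 : 2 * Real.pi / Real.sqrt 6 * Real.sqrt n - (x * j + x / n * (j : ℝ) ^ 2) ≤
        2 * Real.pi / Real.sqrt 6 * Real.sqrt ((n - j : ℕ) : ℝ) := by
      rw [hexp, hsub, Real.sqrt_mul hn'.le]
      have := sqrt_one_sub_ge ht0.le ht1
      have h2 : 0 ≤ 2 * Real.pi / Real.sqrt 6 * Real.sqrt n := by
        have := Real.pi_pos; positivity
      nlinarith [mul_le_mul_of_nonneg_left this h2]
    have h2 : Real.exp (600 * t) * (1 - t) ^ 600 ≤ 1 := by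
      have h3 : 1 - t ≤ Real.exp (-t) := by linarith [Real.add_one_le_exp (-t)]
      calc Real.exp (600 * t) * (1 - t) ^ 600
          ≤ Real.exp (600 * t) * Real.exp (-t) ^ 600 := by
            gcongr
        _ = 1 := by
            rw [← Real.exp_nat_mul, ← Real.exp_add]
            norm_num
    unfold lowerModel
    rw [hsub, mul_pow]
    have ht1' : 0 < 1 - t := by linarith
    rw [le_div_iff₀ (by positivity)]
    rw [hsub] at h1
    have h600 : 600 / (n : ℝ) * j = 600 * t := by rw [ht]; ring
    have h4 : 1 + 600 / n * j - x / n * (j : ℝ) ^ 2 ≤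
        Real.exp (600 * t) * Real.exp (-(x / n * (j : ℝ) ^ 2)) := by
      rw [← Real.exp_add, h600]
      linarith [Real.add_one_le_exp (600 * t + -(x / n * (j : ℝ) ^ 2))]
    calc _ ≤ Real.exp (2 * Real.pi / Real.sqrt 6 * Real.sqrt n) / (n : ℝ) ^ 600 *
          (Real.exp (-(x * j)) * (Real.exp (600 * t) * Real.exp (-(x / n * (j : ℝ) ^ 2)))) *
          ((n : ℝ) ^ 600 * (1 - t) ^ 600) := by gcongr
      _ = Real.exp (2 * Real.pi / Real.sqrt 6 * Real.sqrt n - (x * j + x / n * (j : ℝ) ^ 2)) *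
          (Real.exp (600 * t) * (1 - t) ^ 600) := by
          rw [show 2 * Real.pi / Real.sqrt 6 * Real.sqrt n - (x * j + x / n * (j : ℝ) ^ 2) =
            2 * Real.pi / Real.sqrt 6 * Real.sqrt n + -(x * j) + -(x / n * (j : ℝ) ^ 2) by ring,
            Real.exp_add, Real.exp_add]
          field_simp
      _ ≤ Real.exp (2 * Real.pi / Real.sqrt 6 * Real.sqrt (n * (1 - t))) * 1 := by gcongr
      _ = _ := mul_one _
  -- For `j ≥ n` the bracket is nonpositive because `x * n ≥ 601`; hence the finite recurrence sums
  -- may later be compared with full infinite series.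
  · have hjn' : (n : ℝ) ≤ j := by exact_mod_cast hjn
    have hneg : 1 + 600 / n * j - x / n * (j : ℝ) ^ 2 ≤ 0 := by
      have h1 : 1 + 600 / n * j - x / n * (j : ℝ) ^ 2 = 1 + j / n * (600 - x * j) := by
        field_simp; ring
      have h2 : 1 ≤ (j : ℝ) / n := by rw [le_div_iff₀ hn']; linarith
      have h3 : 601 ≤ x * j := hbig.trans (by gcongr)
      rw [h1]
      nlinarith
    have hle : lowerModel n * (Real.exp (-(x * j)) * (1 + 600 / n * j - x / n * (j : ℝ) ^ 2)) ≤ 0 :=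
      mul_nonpos_of_nonneg_of_nonpos hA.le
        (mul_nonpos_of_nonneg_of_nonpos (Real.exp_pos _).le hneg)
    refine hle.trans ?_
    split_ifs
    · unfold lowerModel; positivity
    · exact le_rfl

theorem sum_inv_sq_Icc_ge {K : ℕ} (hK : 0 < K) :
    Real.pi ^ 2 / 6 - 1 / K ≤ ∑ k ∈ Finset.Icc 1 K, 1 / (k : ℝ) ^ 2 := by
  have hle : ∀ m, K ≤ m →
      ∑ k ∈ Finset.Icc 1 m, 1 / (k : ℝ) ^ 2 + 1 / (m : ℝ) ≤
        ∑ k ∈ Finset.Icc 1 K, 1 / (k : ℝ) ^ 2 + 1 / (K : ℝ) := by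
    intro m hm
    induction m, hm using Nat.le_induction with
    | base => exact le_rfl
    | succ m hm ih =>
      refine le_trans ?_ ih
      rw [Finset.sum_Icc_succ_top (by omega), add_assoc]
      gcongr
      have hm0 : (0 : ℝ) < m := by exact_mod_cast (by omega : 0 < m)
      push_cast
      rw [div_add_div _ _ (by positivity) (by positivity), div_le_div_iff₀ (by positivity) hm0]
      nlinarith
  have hs : Filter.Tendsto (fun m : ℕ => ∑ k ∈ Finset.Icc 1 m, 1 / (k : ℝ) ^ 2) Filter.atTop
      (nhds (Real.pi ^ 2 / 6)) := by
    refine ((Filter.tendsto_add_atTop_iff_nat 1).2 hasSum_zeta_two.tendsto_sum_nat).congr fun m => ?_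
    rw [Finset.sum_range_succ', Finset.range_eq_Ico,
      Finset.sum_Ico_add' (fun k : ℕ => 1 / (k : ℝ) ^ 2) 0 m 1]
    simp only [Nat.cast_zero, ne_eq, OfNat.ofNat_ne_zero, not_false_eq_true, zero_pow, div_zero,
      add_zero]
    exact Finset.sum_congr (by ext; simp) fun _ _ => rfl
  rw [sub_le_iff_le_add]
  refine le_of_tendsto hs (Filter.eventually_atTop.2 ⟨K, fun m hm => ?_⟩)
  have h1 := hle m hm
  have h2 : (0 : ℝ) ≤ 1 / (m : ℝ) := by positivity
  linarith

theorem sum_inv_sq_Icc_le (K : ℕ) : ∑ k ∈ Finset.Icc 1 K, 1 / (k : ℝ) ^ 2 ≤ 2 := by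
  refine (hasSum_zeta_two.summable.sum_le_tsum _ fun _ _ => by positivity).trans ?_
  rw [hasSum_zeta_two.tsum_eq]
  nlinarith [Real.pi_lt_d2, Real.pi_pos]

/-- Inserting the model into the double-counting inequality gives the main term `ζ(2) / x ^ 2 = n`;
the exponent `600` is large enough for the linear gain to outweigh all error terms. -/
theorem card_recurrence_step {n : ℕ} {δ : ℝ} (hδ : 0 ≤ δ) (hn : 2000000 ≤ n)
    (ih : ∀ m < n, δ * lowerModel m ≤ Fintype.card (Nat.Partition m)) :
    δ * lowerModel n ≤ Fintype.card (Nat.Partition n) := by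
  obtain ⟨x, hx⟩ : ∃ x, x = Real.pi / (Real.sqrt 6 * Real.sqrt n) := ⟨_, rfl⟩
  have hnR : (2000000 : ℝ) ≤ n := by exact_mod_cast hn
  have hn0 : (0 : ℝ) < n := by linarith
  have hA : 0 < lowerModel n := by
    have : (0 : ℝ) < n := hn0
    unfold lowerModel; positivity
  have hx0 : 0 < x := by rw [hx]; have := Real.pi_pos; positivity
  have hxn : x ^ 2 * n = Real.pi ^ 2 / 6 := by
    rw [hx, div_pow, mul_pow, Real.sq_sqrt (by norm_num), Real.sq_sqrt hn0.le]
    field_simp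
  have hpi3 := Real.pi_gt_three
  have hpi4 := Real.pi_lt_d2
  have hxn1 : 1.5 ≤ x ^ 2 * n := by rw [hxn]; nlinarith
  have hxn2 : x ^ 2 * n ≤ 1.7 := by rw [hxn]; nlinarith
  have hbig : 601 ≤ x * n := by
    have : (x * n) ^ 2 = (x ^ 2 * n) * n := by ring
    nlinarith [mul_pos hx0 hn0]
  have hx1 : x ≤ 1 / 2 := by
    by_contra! h
    nlinarith
  -- Exactly the rows with `x * k ≤ 1`, where `row_sum_ge` applies.
  set K := ⌊1 / x⌋₊ with hKdef
  have hK1 : (K : ℝ) ≤ 1 / x := Nat.floor_le (by positivity)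
  have hK2 : 1 / (2 * x) ≤ K := by
    have h1 := Nat.lt_floor_add_one (1 / x)
    have h2 : 1 / x = 2 * (1 / (2 * x)) := by field_simp
    have h3 : 1 ≤ 1 / (2 * x) := by rw [le_div_iff₀ (by positivity)]; linarith
    linarith
  have hK0' : (0 : ℝ) < K := lt_of_lt_of_le (by positivity) hK2
  have hK0 : 0 < K := by exact_mod_cast hK0'
  have hrow : ∀ k ∈ Finset.Icc 1 K,
      δ * lowerModel n * (1 / x ^ 2 * (1 / (k : ℝ) ^ 2) - 1 / 2 +
        (if k = 1 then 200 / (n * x ^ 3) else 0) - 96 / (n * x ^ 3) * (1 / (k : ℝ) ^ 2)) ≤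
      ((∑ v ∈ (Finset.Icc 1 n).filter (fun v => k * v ≤ n),
        v * Fintype.card (Nat.Partition (n - k * v)) : ℕ) : ℝ) := by
    intro k hk
    obtain ⟨hk1, hkK⟩ := Finset.mem_Icc.1 hk
    have hk0 : (0 : ℝ) < k := by exact_mod_cast hk1
    have hkx : x * k ≤ 1 := by
      have : (k : ℝ) ≤ 1 / x := le_trans (by exact_mod_cast hkK) hK1
      rw [le_div_iff₀ hx0] at this
      linarith
    obtain ⟨s, hs, hsge⟩ := row_sum_ge (y := x * k) (b := 600 / n * k) (c := x / n * k ^ 2)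
      (by positivity) hkx (by positivity) (by positivity)
    have hterm : ∀ i : ℕ, δ * lowerModel n * (((i : ℝ) + 1) * Real.exp (-(x * k * (i + 1))) *
        (1 + 600 / n * k * (i + 1) - x / n * k ^ 2 * ((i : ℝ) + 1) ^ 2)) ≤
        ((i : ℝ) + 1) * (if k * (i + 1) ≤ n then (Fintype.card (Nat.Partition (n - k * (i + 1))) : ℝ)
          else 0) := by
      intro i
      have h1 := lowerModel_sub_ge (j := k * (i + 1)) (by omega) hx hbig (by positivity)
      have h2 : δ * (if k * (i + 1) ≤ n then lowerModel (n - k * (i + 1)) else 0) ≤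
          (if k * (i + 1) ≤ n then (Fintype.card (Nat.Partition (n - k * (i + 1))) : ℝ) else 0) := by
        split_ifs with h
        · refine ih _ (Nat.sub_lt (by omega) (by positivity))
        · simp
      calc _ = ((i : ℝ) + 1) * (δ * (lowerModel n * (Real.exp (-(x * (k * (i + 1) : ℕ))) *
            (1 + 600 / n * (k * (i + 1) : ℕ) - x / n * ((k * (i + 1) : ℕ) : ℝ) ^ 2)))) := by
            push_cast; ring_nf
        _ ≤ ((i : ℝ) + 1) *
            (δ * (if k * (i + 1) ≤ n then lowerModel (n - k * (i + 1)) else 0)) := by gcongr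
        _ ≤ _ := by gcongr
    have hsum : δ * lowerModel n * s ≤ ∑ i ∈ Finset.range n, ((i : ℝ) + 1) *
        (if k * (i + 1) ≤ n then (Fintype.card (Nat.Partition (n - k * (i + 1))) : ℝ) else 0) := by
      refine hasSum_le hterm (hs.mul_left _) (hasSum_sum_of_ne_finset_zero fun i hi => ?_)
      rw [Finset.mem_range, not_lt] at hi
      rw [if_neg, mul_zero]
      have : 1 * (i + 1) ≤ k * (i + 1) := Nat.mul_le_mul_right _ hk1
      omega
    have hre : (∑ i ∈ Finset.range n, ((i : ℝ) + 1) *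
        (if k * (i + 1) ≤ n then (Fintype.card (Nat.Partition (n - k * (i + 1))) : ℝ) else 0)) =
        ((∑ v ∈ (Finset.Icc 1 n).filter (fun v => k * v ≤ n),
        v * Fintype.card (Nat.Partition (n - k * v)) : ℕ) : ℝ) := by
      rw [Finset.sum_filter, Finset.range_eq_Ico]
      push_cast
      have : Finset.Icc 1 n = Finset.Ico (0 + 1) (n + 1) := by ext; simp
      rw [this, ← Finset.sum_Ico_add' _ 0 n 1]
      refine Finset.sum_congr rfl fun i _ => ?_
      split_ifs <;> simp
    rw [← hre]
    refine le_trans ?_ hsum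
    refine mul_le_mul_of_nonneg_left (le_trans ?_ hsge) (by positivity)
    have e1 : 1 / (x * k) ^ 2 = 1 / x ^ 2 * (1 / (k : ℝ) ^ 2) := by field_simp
    have e2 : x / n * k ^ 2 * (96 / (x * k) ^ 4) = 96 / (n * x ^ 3) * (1 / (k : ℝ) ^ 2) := by
      field_simp
    -- The linear gain is kept only in the row `k = 1`, where it is `600 / 3 = 200`.
    have e3 : (if k = 1 then 200 / (n * x ^ 3) else 0) ≤ 600 / n * k * (1 / (3 * (x * k) ^ 3)) := by
      split_ifs with h
      · rw [h]
        apply le_of_eq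
        push_cast
        field_simp
        norm_num
      · positivity
    rw [e1, e2]
    linarith
  have hall := Finset.sum_le_sum hrow
  rw [← Finset.mul_sum, Finset.sum_sub_distrib, Finset.sum_add_distrib, Finset.sum_sub_distrib,
    ← Finset.mul_sum, ← Finset.mul_sum, Finset.sum_ite_eq', if_pos (Finset.mem_Icc.2 ⟨le_rfl, hK0⟩),
    Finset.sum_const, Nat.card_Icc, nsmul_eq_mul, ← Nat.cast_sum] at hall
  have hcomb : ((∑ k ∈ Finset.Icc 1 K, ∑ v ∈ (Finset.Icc 1 n).filter (fun v => k * v ≤ n),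
      v * Fintype.card (Nat.Partition (n - k * v)) : ℕ) : ℝ) ≤
      n * Fintype.card (Nat.Partition n) := by exact_mod_cast sum_mul_card_le n K
  have hmain : (n : ℝ) ≤ 1 / x ^ 2 * ∑ k ∈ Finset.Icc 1 K, 1 / (k : ℝ) ^ 2 -
      ((K + 1 - 1 : ℕ) : ℝ) * (1 / 2) + 200 / (n * x ^ 3) -
      96 / (n * x ^ 3) * ∑ k ∈ Finset.Icc 1 K, 1 / (k : ℝ) ^ 2 := by
    rw [Nat.add_sub_cancel]
    have g1 : 1 / x ^ 2 * (Real.pi ^ 2 / 6 - 1 / K) ≤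
        1 / x ^ 2 * ∑ k ∈ Finset.Icc 1 K, 1 / (k : ℝ) ^ 2 := by
      gcongr
      exact sum_inv_sq_Icc_ge hK0
    have g2 : 96 / (n * x ^ 3) * ∑ k ∈ Finset.Icc 1 K, 1 / (k : ℝ) ^ 2 ≤ 96 / (n * x ^ 3) * 2 := by
      gcongr
      exact sum_inv_sq_Icc_le K
    have g3 : 1 / x ^ 2 * (Real.pi ^ 2 / 6) = n := by
      rw [← hxn]; field_simp
    have g4 : 1 / (K : ℝ) ≤ 2 * x := by
      rw [div_le_iff₀ hK0']
      rw [div_le_iff₀ (by positivity)] at hK2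
      linarith
    have g5 : 1 / x ^ 2 * (1 / K) ≤ 2 / x := by
      calc 1 / x ^ 2 * (1 / K) ≤ 1 / x ^ 2 * (2 * x) := by gcongr
        _ = 2 / x := by field_simp
    -- The surplus `200 - 2 * 96 = 8` must cover the tail of `ζ(2)`, at most `2 / x`, and the `K`
    -- losses of `1 / 2`, at most `1 / (2 * x)`.
    have g6 : 4 / x ≤ 8 / (n * x ^ 3) := by
      rw [div_le_div_iff₀ hx0 (by positivity)]
      nlinarith
    have g7 : 200 / (n * x ^ 3) - 96 / (n * x ^ 3) * 2 = 8 / (n * x ^ 3) := by ring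
    have g8 : 4 / x = 4 * (1 / x) := by ring
    have g9 : 2 / x = 2 * (1 / x) := by ring
    have g10 : 0 < 1 / x := by positivity
    rw [mul_sub, g3] at g1
    linarith
  have hfin : n * (δ * lowerModel n) ≤ n * Fintype.card (Nat.Partition n) := by
    calc n * (δ * lowerModel n) = δ * lowerModel n * n := by ring
      _ ≤ _ := mul_le_mul_of_nonneg_left hmain (by positivity)
      _ ≤ _ := hall
      _ ≤ _ := hcomb
  exact le_of_mul_le_mul_left hfin hn0

theorem exists_card_ge : ∃ δ : ℝ, 0 < δ ∧ ∀ n : ℕ, 1 ≤ n →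
    δ * (Real.exp (2 * Real.pi / Real.sqrt 6 * Real.sqrt n) / (n : ℝ) ^ 600) ≤
      Fintype.card (Nat.Partition n) := by
  -- This constant makes the bound at most `1` for every positive `n` below the threshold of the
  -- induction step.
  refine ⟨(Real.exp (2 * Real.pi / Real.sqrt 6 * Real.sqrt 2000000))⁻¹, by positivity, ?_⟩
  intro n _
  change _ * lowerModel n ≤ _
  induction n using Nat.strong_induction_on with
  | _ n ih =>
    rcases le_or_gt 2000000 n with hn | hn
    · refine card_recurrence_step (by positivity) hn fun m hm => ?_
      rcases Nat.eq_zero_or_pos m with rfl | hm0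
      -- At `0` the model is a division by zero, hence `0`.
      · unfold lowerModel
        simp
      · exact ih m hm hm0
    · have h1 : (1 : ℝ) ≤ Fintype.card (Nat.Partition n) := by
        exact_mod_cast Fintype.card_pos
      refine le_trans ?_ h1
      rw [inv_mul_le_iff₀ (Real.exp_pos _), mul_one]
      unfold lowerModel
      have hn1 : (1 : ℝ) ≤ n := by assumption_mod_cast
      refine (_root_.div_le_self (Real.exp_pos _).le (one_le_pow₀ hn1)).trans ?_
      have : (n : ℝ) ≤ 2000000 := by exact_mod_cast hn.le
      have hpi := Real.pi_pos
      gcongr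

end Nat.Partition

/-! ### From groups of candidate chains to a count of exceptional partitions -/

/-- If each of the `r` disjoint groups contains a good chain, the partition is not exceptional; a
union bound over the groups finishes. The condition `a * p ^ J ≤ n` keeps the relevant variables
among those determined by the partition. -/
theorem IsBoltzmannFamily.ncard_not_hasManyLargeParts_mul_le {Ω : Type*} [MeasurableSpace Ω]
    {P : Measure Ω} [IsProbabilityMeasure P] {x : ℝ} {X : ℕ → Ω → ℕ} (h : IsBoltzmannFamily P x X)
    {n p r J K H : ℕ} (hp : p.Prime) (hr : 1 ≤ r) {ρ : ℝ} (hρ0 : 0 ≤ ρ) (G : Fin r → Finset ℕ)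
    (hdisj : Pairwise fun g g' => Disjoint (G g) (G g'))
    (hG : ∀ g, ∀ a ∈ G g, ¬ p ∣ a) (hn : ∀ g, ∀ a ∈ G g, a * p ^ J ≤ n)
    (hT : ∀ g, ∀ a ∈ G g, (1 + 1 / (6 * (p : ℝ) ^ r)) * (Real.sqrt 6 / (2 * Real.pi)) *
      Real.sqrt n * Real.log n < (p : ℝ) ^ (r - 1) * ((a * p ^ K : ℕ) : ℝ))
    (hρ : ∀ g, ∀ a ∈ G g, ρ ≤ P.real (good X p (p ^ (r - 1)) J (p ^ K) a))
    (hH : ∀ g, H ≤ (G g).card) :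
    (Set.ncard {μ : Nat.Partition n | ¬ HasManyLargeParts p r (fullCombination hp hr μ)} : ℝ) *
      (Real.exp (-(x * n)) * ∏ m ∈ Finset.Icc 1 n, (1 - Real.exp (-(x * m)))) ≤
      r * Real.exp (-(ρ * H)) := by
  let E : Fin r → Set Ω := fun g => ⋂ a ∈ G g, (good X p (p ^ (r - 1)) J (p ^ K) a)ᶜ
  refine (h.ncard_mul_le _ (⋃ g, E g) ?_).trans ?_
  · intro μ hμ ω hω
    by_contra hE
    have hE' : ∀ g, ∃ a ∈ G g, ω ∈ good X p (p ^ (r - 1)) J (p ^ K) a := by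
      intro g
      by_contra! hc
      exact hE (Set.mem_iUnion.2 ⟨g, Set.mem_iInter₂.2 fun a ha => hc a ha⟩)
    choose a ha hgood using hE'
    refine hμ (hasManyLargeParts_of_chainWeight (K := K) hp hr μ a ?_ (fun g => hG g _ (ha g)) ?_
      (fun g => hT g _ (ha g)))
    · intro g g' hgg
      by_contra hne
      exact Finset.disjoint_left.1 (hdisj hne) (ha g) (hgg ▸ ha g')
    · intro g
      have hapos := pos_of_not_dvd (hG g _ (ha g))
      have hle := hn g _ (ha g)
      refine le_trans (hgood g) ?_
      unfold chainWeight
      have hJ : J < n + 1 := by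
        have h1 : J < p ^ J := Nat.lt_pow_self hp.one_lt
        have h2 : 1 * p ^ J ≤ a g * p ^ J := Nat.mul_le_mul_right _ hapos
        omega
      refine le_trans (Finset.sum_le_sum fun k hk => ?_) (Finset.sum_le_sum_of_subset
        (Finset.range_subset_range.2 (by omega : J + 1 ≤ n + 1)))
      have hk' : k ≤ J := by have := Finset.mem_range.1 hk; omega
      rw [hω]
      rw [Finset.mem_Icc]
      refine ⟨Nat.mul_pos hapos (pow_pos hp.pos _), le_trans ?_ hle⟩
      exact Nat.mul_le_mul_left _ (Nat.pow_le_pow_right hp.pos hk')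
  · refine (measureReal_iUnion_fintype_le E).trans ?_
    calc ∑ g, P.real (E g) ≤ ∑ _g : Fin r, Real.exp (-(ρ * H)) := by
          refine Finset.sum_le_sum fun g _ =>
            (h.real_iInter_compl_good_le hp (G g) (hG g) (hρ g)).trans ?_
          have : (H : ℝ) ≤ (G g).card := by exact_mod_cast hH g
          gcongr
      _ = _ := by simp

theorem exp_neg_le_exp_mul_prod {n : ℕ} {x : ℝ} (hn : 0 < n)
    (hx : x = Real.pi / (Real.sqrt 6 * Real.sqrt n)) :
    Real.exp (-(2 * Real.pi / Real.sqrt 6 * Real.sqrt n)) ≤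
      Real.exp (-(x * n)) * ∏ m ∈ Finset.Icc 1 n, (1 - Real.exp (-(x * m))) := by
  have hpi := Real.pi_pos
  have hn' : (0 : ℝ) < n := by exact_mod_cast hn
  have hs := Real.sqrt_pos.2 hn'
  have hx0 : 0 < x := by rw [hx]; positivity
  have e : -(2 * Real.pi / Real.sqrt 6 * Real.sqrt n) =
      -(x * n) + -(Real.pi ^ 2 / (6 * x)) := by
    have h1 : Real.sqrt n ^ 2 = n := Real.sq_sqrt hn'.le
    have h2 : Real.sqrt 6 ^ 2 = 6 := Real.sq_sqrt (by norm_num)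
    have h3 : x * n = Real.pi / Real.sqrt 6 * Real.sqrt n := by
      rw [hx]; field_simp; rw [h1]
    have h4 : Real.pi ^ 2 / (6 * x) = Real.pi / Real.sqrt 6 * Real.sqrt n := by
      rw [hx]; field_simp; rw [h2]
    rw [h3, h4]; ring
  rw [e, Real.exp_add]
  gcongr
  exact exp_neg_le_prod hx0 n

/-- Lower bound for the probability that the chain of `a` carries the weight `p ^ (J + i)`. -/
theorem IsBoltzmannFamily.real_good_ge_of_le {Ω : Type*} [MeasurableSpace Ω]
    {P : Measure Ω} [IsProbabilityMeasure P] {x : ℝ} {X : ℕ → Ω → ℕ} (h : IsBoltzmannFamily P x X)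
    {p s J i a : ℕ} (hp : 1 < p) (hs : 0 < s) (ha : 0 < a) (hJ : 0 < J) {L N : ℝ} (hL : 0 < L)
    (hN : 1 ≤ N) (hi : L ^ 2 ≤ (p : ℝ) ^ i) (hJL : (J : ℝ) ≤ L / (4 * N))
    (hl1 : L / 2 ≤ x * a * s * p ^ (J + i)) (hl2 : x * a * s * p ^ (J + i) ≤ L) :
    Real.exp (-(x * a * s * p ^ (J + i))) * ((2 * N) ^ J / 2) ≤
      P.real (good X p s J (p ^ (J + i)) a) := by
  have hp0 : (0 : ℝ) < p := by exact_mod_cast (by omega : 0 < p)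
  have hJ' : (0 : ℝ) < J := by exact_mod_cast hJ
  obtain ⟨l, hl⟩ : ∃ l, l = x * a * s * (p : ℝ) ^ (J + i) := ⟨_, rfl⟩
  rw [← hl] at hl1 hl2 ⊢
  -- Each of the `J` levels may use up to a share `1 / J` of the total weight.
  have hb : ∑ k : Fin J, p ^ (k.val + 1) * (p ^ (J + i - (k.val + 1)) / J) ≤ p ^ (J + i) := by
    have h1 : ∀ k : Fin J, p ^ (k.val + 1) * (p ^ (J + i - (k.val + 1)) / J) ≤ p ^ (J + i) / J := by
      intro k
      refine (Nat.mul_div_le_mul_div_assoc _ _ _).trans ?_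
      rw [← pow_add, Nat.add_sub_cancel' (by omega)]
    refine (Finset.sum_le_sum fun k _ => h1 k).trans ?_
    rw [Finset.sum_const, Finset.card_univ, Fintype.card_fin, smul_eq_mul]
    exact Nat.mul_div_le _ _
  refine le_trans ?_ (h.real_good_ge hp hs ha (fun k => p ^ (J + i - (k.val + 1)) / J) hb)
  have e1 : -(x * a * s) * ((p ^ (J + i) : ℕ) : ℝ) = -l := by rw [hl]; push_cast; ring
  rw [e1]
  refine mul_le_mul_of_nonneg_left ?_ (Real.exp_pos _).le
  have hL2N : 2 * N ≤ l / J := by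
    rw [le_div_iff₀ hJ']
    rw [le_div_iff₀ (by positivity)] at hJL
    linarith
  have hl0 : 0 < l := by linarith
  have hJL' : (J : ℝ) ≤ L := hJL.trans (by
    rw [div_le_iff₀ (by positivity)]; nlinarith)
  -- The geometric factor is about `l / y` and the number of choices about `y / J`, so the product
  -- is about `l / J ≥ 2 * N` at every level. The condition `L ^ 2 ≤ p ^ i` keeps `l / y ≤ 1 / L`
  -- even at the top level, so the `J` relative errors together cost at most a factor `2`.
  have hfac : ∀ k : Fin J, 2 * N * (1 - 1 / (2 * L)) ≤
      (1 - Real.exp (-(x * a * s) * p ^ (k.val + 1))) *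
        (((p ^ (J + i - (k.val + 1)) / J : ℕ) : ℝ) + 1) := by
    intro k
    set y : ℝ := (p : ℝ) ^ (J + i - (k.val + 1)) with hy
    have hy0 : 0 < y := by positivity
    have hye : (p : ℝ) ^ (J + i) = p ^ (k.val + 1) * y := by
      rw [hy, ← pow_add, Nat.add_sub_cancel' (by omega)]
    have hyL : L ^ 2 ≤ y := hi.trans (pow_le_pow_right₀ (by exact_mod_cast hp.le) (by omega))
    have ht : x * a * s * (p : ℝ) ^ (k.val + 1) = l / y := by
      rw [hl, hye]; field_simp
    have htL : l / y ≤ 1 / L := by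
      rw [div_le_div_iff₀ hy0 hL]
      nlinarith
    have ht0 : 0 < l / y := by positivity
    have hexp : l / y * (1 - 1 / (2 * L)) ≤ 1 - Real.exp (-(l / y)) := by
      have h1 : Real.exp (-(l / y)) ≤ 1 - l / y + (l / y) ^ 2 / 2 := by
        have h2 := Real.quadratic_le_exp_of_nonneg ht0.le
        have h3 : Real.exp (-(l / y)) * Real.exp (l / y) = 1 := by rw [← Real.exp_add]; simp
        have h4 : 0 ≤ 1 - l / y + (l / y) ^ 2 / 2 := by nlinarith [sq_nonneg (l / y - 1)]
        have h5 : 1 ≤ (1 - l / y + (l / y) ^ 2 / 2) * (1 + l / y + (l / y) ^ 2 / 2) := by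
          nlinarith [sq_nonneg ((l / y) ^ 2)]
        have h6 : 1 ≤ (1 - l / y + (l / y) ^ 2 / 2) * Real.exp (l / y) :=
          h5.trans (mul_le_mul_of_nonneg_left h2 h4)
        nlinarith [Real.exp_pos (-(l / y))]
      have h7 : 1 / (2 * L) = 1 / L / 2 := by ring
      rw [h7]
      nlinarith
    have hfl : y / J ≤ ((p ^ (J + i - (k.val + 1)) / J : ℕ) : ℝ) + 1 := by
      rw [div_le_iff₀ hJ', hy]
      have := Nat.lt_mul_div_succ (p ^ (J + i - (k.val + 1))) hJ
      have h8 : ((p ^ (J + i - (k.val + 1)) : ℕ) : ℝ) ≤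
          ((J * (p ^ (J + i - (k.val + 1)) / J + 1) : ℕ) : ℝ) := by exact_mod_cast this.le
      push_cast at h8 ⊢
      linarith
    by_cases hneg : 1 - 1 / (2 * L) ≤ 0
    · have hpos : 0 ≤ 1 - Real.exp (-(l / y)) := by
        have := Real.exp_le_one_iff.2 (by linarith : -(l / y) ≤ 0)
        linarith
      rw [neg_mul, ht]
      exact (mul_nonpos_of_nonneg_of_nonpos (by positivity) hneg).trans
        (mul_nonneg hpos (by positivity))
    · push Not at hneg
      rw [neg_mul, ht]
      calc 2 * N * (1 - 1 / (2 * L)) ≤ l / J * (1 - 1 / (2 * L)) := by gcongr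
        _ = (l / y * (1 - 1 / (2 * L))) * (y / J) := by field_simp
        _ ≤ _ := by gcongr; exact (mul_pos ht0 hneg).le.trans hexp
  have hL1 : 1 ≤ L := by
    have : (1 : ℝ) ≤ J := by exact_mod_cast hJ
    linarith
  have hhalf : 1 / (2 * L) ≤ 1 / 2 := by
    rw [div_le_div_iff₀ (by positivity) (by norm_num)]; linarith
  have hbern : (1 : ℝ) / 2 ≤ (1 - 1 / (2 * L)) ^ J := by
    have h1 := one_add_mul_le_pow (a := -(1 / (2 * L))) (by linarith) J
    have h2 : (J : ℝ) * (1 / (2 * L)) ≤ 1 / 2 := by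
      rw [mul_one_div, div_le_div_iff₀ (by positivity) (by norm_num)]; linarith
    rw [← sub_eq_add_neg] at h1
    linarith
  calc (2 * N) ^ J / 2 = (2 * N) ^ J * (1 / 2) := by ring
    _ ≤ (2 * N) ^ J * (1 - 1 / (2 * L)) ^ J := by gcongr
    _ = ∏ _k : Fin J, 2 * N * (1 - 1 / (2 * L)) := by
      rw [Finset.prod_const, Finset.card_univ, Fintype.card_fin, ← mul_pow]
    _ ≤ _ := Finset.prod_le_prod (fun k _ => mul_nonneg (by positivity) (by linarith))
      fun k _ => hfac k

/-- Take consecutive integers congruent to `1` modulo `p` just above `T / Q` and cut them into `r`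
runs of length `H`. -/
theorem exists_groups {p Q r H : ℕ} (hp : p.Prime) (hQ : 0 < Q) {T W : ℝ} (hT : 0 ≤ T)
    (hW : (Q : ℝ) * p * (1 + r * H) ≤ W) :
    ∃ G : Fin r → Finset ℕ, (Pairwise fun g g' => Disjoint (G g) (G g')) ∧
      (∀ g, ∀ a ∈ G g, ¬ p ∣ a ∧ T < Q * (a : ℝ) ∧ Q * (a : ℝ) ≤ T + W) ∧
      ∀ g, (G g).card = H := by
  have hp1 : (1 : ℝ) ≤ p := by exact_mod_cast hp.one_lt.le
  have hQ' : (0 : ℝ) < Q := by exact_mod_cast hQ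
  set t := ⌊T / (Q * p)⌋₊ + 1 with ht
  have hlo : T < Q * p * t := by
    have := Nat.lt_floor_add_one (T / (Q * p))
    rw [div_lt_iff₀ (by positivity)] at this
    rw [ht]; push_cast; linarith
  have hhi : Q * p * (t : ℝ) ≤ T + Q * p := by
    have := Nat.floor_le (a := T / (Q * p)) (by positivity)
    rw [le_div_iff₀ (by positivity)] at this
    rw [ht]; push_cast; linarith
  have hinj : ∀ i j : ℕ, p * i + 1 = p * j + 1 → i = j := fun i j h =>
    Nat.eq_of_mul_eq_mul_left hp.pos (Nat.succ_injective h)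
  refine ⟨fun g => (Finset.range H).image fun j => p * (t + (g.val * H + j)) + 1, ?_, ?_, ?_⟩
  · intro g g' hne
    refine Finset.disjoint_left.2 fun a ha ha' => hne (Fin.ext ?_)
    obtain ⟨i, hi, rfl⟩ := Finset.mem_image.1 ha
    obtain ⟨j, hj, hij⟩ := Finset.mem_image.1 ha'
    have h1 := hinj _ _ hij
    rw [Finset.mem_range] at hi hj
    have h2 : g'.val * H + j = g.val * H + i := by omega
    have h3 : ∀ c k, k < H → (c * H + k) / H = c := fun c k hk => by
      rw [mul_comm, Nat.mul_add_div (by omega), Nat.div_eq_of_lt hk, add_zero]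
    rw [← h3 g i hi, ← h2, h3 g' j hj]
  · intro g a ha
    obtain ⟨j, hj, rfl⟩ := Finset.mem_image.1 ha
    rw [Finset.mem_range] at hj
    have hlt : g.val * H + j + 1 ≤ r * H := by
      have : (g.val + 1) * H ≤ r * H := Nat.mul_le_mul_right _ g.isLt
      rw [add_mul, one_mul] at this
      omega
    have hlt' : ((g.val * H + j : ℕ) : ℝ) + 1 ≤ r * H := by exact_mod_cast hlt
    have hnn : (0 : ℝ) ≤ ((g.val * H + j : ℕ) : ℝ) := Nat.cast_nonneg _
    refine ⟨fun hd => hp.one_lt.ne' (Nat.dvd_one.1 ((Nat.dvd_add_right ⟨_, rfl⟩).1 hd)), ?_, ?_⟩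
    · rw [Nat.cast_add, Nat.cast_mul, Nat.cast_add]
      have : 0 ≤ Q * p * ((g.val * H + j : ℕ) : ℝ) := by positivity
      push_cast at *
      nlinarith
    · rw [Nat.cast_add, Nat.cast_mul, Nat.cast_add, Nat.cast_one]
      have h1 : Q * p * (((g.val * H + j : ℕ) : ℝ) + 1) ≤ Q * p * (r * H) := by gcongr
      have h2 : (Q : ℝ) * 1 ≤ Q * p := by gcongr
      nlinarith
  · intro g
    rw [Finset.card_image_of_injective, Finset.card_range]
    intro i j hij
    have := hinj _ _ hij
    omega

/-- Since `p ≤ exp (p / 2)` and `p ≤ N`. With `L = log n` the spacing factor `p ^ J` is at most `n ^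
(1 / 8)`, small against the window of length about `√n`. -/
theorem pow_floor_le_exp {p : ℕ} {N L : ℝ} (hp : 0 < p) (hpN : (p : ℝ) ≤ N) (hL : 0 ≤ L) :
    (p : ℝ) ^ ⌊L / (4 * N)⌋₊ ≤ Real.exp (L / 8) := by
  have hp0 : (0 : ℝ) < p := by exact_mod_cast hp
  have hN0 : 0 < N := hp0.trans_le hpN
  have h1 : (p : ℝ) ≤ Real.exp (p / 2) := by
    have h2 := Real.add_one_le_exp ((p : ℝ) / 2 - 1)
    have h3 : Real.exp ((p : ℝ) / 2) = Real.exp 1 * Real.exp ((p : ℝ) / 2 - 1) := by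
      rw [← Real.exp_add]; ring_nf
    rw [h3]
    nlinarith [Real.exp_one_gt_d9]
  calc (p : ℝ) ^ ⌊L / (4 * N)⌋₊ ≤ Real.exp (p / 2) ^ ⌊L / (4 * N)⌋₊ := by gcongr
    _ = Real.exp (⌊L / (4 * N)⌋₊ * (p / 2)) := by rw [← Real.exp_nat_mul]
    _ ≤ Real.exp (L / 8) := by
      have h4 : (⌊L / (4 * N)⌋₊ : ℝ) ≤ L / (4 * N) := Nat.floor_le (by positivity)
      have h5 : (⌊L / (4 * N)⌋₊ : ℝ) * (p / 2) ≤ L / (4 * N) * (N / 2) := by gcongr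
      have h6 : L / (4 * N) * (N / 2) = L / 8 := by field_simp; ring
      rw [h6] at h5
      exact Real.exp_le_exp.2 h5

theorem two_pow_floor_ge {w : ℝ} (hw : 0 ≤ w) : Real.exp (0.6931 * w) / 2 ≤ 2 ^ ⌊w⌋₊ := by
  have h1 : w ≤ (⌊w⌋₊ : ℝ) + 1 := (Nat.lt_floor_add_one w).le
  have h2 : (2 : ℝ) ^ (⌊w⌋₊ + 1) = Real.exp (Real.log 2 * (⌊w⌋₊ + 1)) := by
    rw [← Real.rpow_natCast, Real.rpow_def_of_pos (by norm_num)]; push_cast; rfl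
  have h3 : Real.exp (0.6931 * w) ≤ 2 ^ (⌊w⌋₊ + 1) := by
    rw [h2]
    have h4 : 0.6931 ≤ Real.log 2 := by linarith [Real.log_two_gt_d9]
    gcongr
  rw [pow_succ] at h3
  linarith

-- Choice of parameters. The exponent `0.0899` comes from `0.6931 / 4 - 1 / 12`: entropy `2 ^ J`
-- with `J ≈ L / (4 * N)`, minus the cost of exceeding the threshold by the factor `1 + 1 / (6 *
-- N)`.
set_option maxHeartbeats 1000000 in
theorem ncard_not_hasManyLargeParts_mul_exp_le {n p r : ℕ} (hp : p.Prime) (hr : 1 ≤ r) {L : ℝ}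
    (hL : L = Real.log n) (hL1 : 1000 ≤ L) (hLe : 4 * L ^ 5 ≤ Real.exp (3 * L / 8))
    (hNL : 4 * (p : ℝ) ^ r ≤ L) :
    (Set.ncard {μ : Nat.Partition n | ¬ HasManyLargeParts p r (fullCombination hp hr μ)} : ℝ) *
      Real.exp (-(2 * Real.pi / Real.sqrt 6 * Real.sqrt n)) ≤
      L * Real.exp (-(Real.exp (0.0899 * (L / (p : ℝ) ^ r)) / (100 * L ^ 5))) := by
  have hn0 : 0 < n := by
    rcases Nat.eq_zero_or_pos n with h | h
    · rw [hL, h] at hL1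
      norm_num at hL1
    · exact h
  have hn' : (0 : ℝ) < n := by exact_mod_cast hn0
  have hnL : Real.exp L = n := by rw [hL, Real.exp_log hn']
  have hsn : Real.sqrt n = Real.exp (L / 2) := by rw [← hnL, Real.exp_half]
  have hpi3 := Real.pi_gt_three
  have hpi4 := Real.pi_lt_d2
  have h6sq : Real.sqrt 6 ^ 2 = 6 := Real.sq_sqrt (by norm_num)
  have h6pos : 0 < Real.sqrt 6 := by positivity
  have hs0 : 0 < Real.sqrt n := Real.sqrt_pos.2 hn'
  obtain ⟨x, hx⟩ : ∃ x, x = Real.pi / (Real.sqrt 6 * Real.sqrt n) := ⟨_, rfl⟩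
  have hx0 : 0 < x := by rw [hx]; positivity
  have hxlo : 1 / x ≤ Real.sqrt n := by
    have : 1 / x = Real.sqrt 6 / Real.pi * Real.sqrt n := by rw [hx]; field_simp
    rw [this]
    refine mul_le_of_le_one_left hs0.le ?_
    rw [div_le_one (by positivity)]
    nlinarith
  have hxhi : x * Real.sqrt n ≤ 2 := by
    have : x * Real.sqrt n = Real.pi / Real.sqrt 6 := by rw [hx]; field_simp
    rw [this, div_le_iff₀ h6pos]
    nlinarith
  obtain ⟨N, hN⟩ : ∃ N, N = (p : ℝ) ^ r := ⟨_, rfl⟩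
  have hp2 : (2 : ℝ) ≤ p := by exact_mod_cast hp.two_le
  have hpN : (p : ℝ) ≤ N := by
    rw [hN]; exact le_self_pow₀ (by linarith) (by omega)
  have hrN : (r : ℝ) ≤ N := by
    rw [hN]; exact_mod_cast (Nat.lt_pow_self hp.one_lt).le
  rw [← hN] at hNL ⊢
  have hN0 : 0 < N := by linarith
  have hL0 : 0 < L := by linarith
  obtain ⟨T, hTdef⟩ : ∃ T, T = (1 + 1 / (6 * N)) * (Real.sqrt 6 / (2 * Real.pi)) *
    Real.sqrt n * L := ⟨_, rfl⟩
  have hT0 : 0 ≤ T := by rw [hTdef]; positivity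
  have hxT : x * T = L / 2 + L / (12 * N) := by
    rw [hTdef, hx]; field_simp; ring
  have hwN : L / (12 * N) ≤ L / 24 := by gcongr; linarith
  have hw0 : 0 ≤ L / (12 * N) := by positivity
  set J := ⌊L / (4 * N)⌋₊ with hJdef
  have hJ0 : 0 < J := Nat.floor_pos.2 (by rw [le_div_iff₀ (by positivity)]; linarith)
  have hJL : (J : ℝ) ≤ L / (4 * N) := Nat.floor_le (by positivity)
  have hpJ : (p : ℝ) ^ J ≤ Real.exp (L / 8) := pow_floor_le_exp hp.pos hpN (by linarith)
  -- The least `i` with `p ^ i > L ^ 2`, so that `p ^ i` costs only a power of `L`.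
  obtain ⟨i', hi1, hi2⟩ := exists_nat_pow_near (x := L ^ 2) (y := (p : ℝ)) (by nlinarith)
    (by linarith)
  obtain ⟨i, rfl⟩ : ∃ i, i = i' + 1 := ⟨_, rfl⟩
  have hi3 : (p : ℝ) ^ (i' + 1) ≤ p * L ^ 2 := by rw [pow_succ']; gcongr
  generalize i' + 1 = i at *
  set Q : ℕ := p ^ (r - 1) * p ^ (J + i) with hQ
  have hQ0 : 0 < Q := Nat.mul_pos (pow_pos hp.pos _) (pow_pos hp.pos _)
  have hQ0' : (0 : ℝ) < Q := by exact_mod_cast hQ0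
  have hQp : (Q : ℝ) * p = N * p ^ J * p ^ i := by
    have h1 : (p : ℝ) ^ r = p ^ (r - 1) * p := by rw [← pow_succ, Nat.sub_add_cancel hr]
    rw [hN, hQ, h1]; push_cast; ring
  have hr0 : (0 : ℝ) < r := by exact_mod_cast hr
  obtain ⟨D, hD⟩ : ∃ D, D = x * (Q * p) := ⟨_, rfl⟩
  have hp0 : (0 : ℝ) < p := by linarith
  have hD0 : 0 < D := by rw [hD]; positivity
  have hDle : D * Real.sqrt n ≤ 2 * L ^ 4 * (p : ℝ) ^ J := by
    calc D * Real.sqrt n = (x * Real.sqrt n) * (N * p ^ J * p ^ i) := by rw [hD, hQp]; ring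
      _ ≤ 2 * (L * p ^ J * (L * L ^ 2)) := by
        have h1 : N ≤ L := by linarith
        have h2 : (p : ℝ) ^ i ≤ L * L ^ 2 := hi3.trans (by gcongr; linarith)
        gcongr
      _ = _ := by ring
  have hrD : 2 * r * D ≤ 1 := by
    have h1 : 2 * r * D * Real.sqrt n ≤ Real.sqrt n := by
      calc 2 * r * D * Real.sqrt n = 2 * r * (D * Real.sqrt n) := by ring
        _ ≤ 2 * L * (2 * L ^ 4 * Real.exp (L / 8)) := by
          have h1 : (r : ℝ) ≤ L := by linarith
          have h2 : D * Real.sqrt n ≤ 2 * L ^ 4 * Real.exp (L / 8) := hDle.trans (by gcongr)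
          gcongr
        _ = 4 * L ^ 5 * Real.exp (L / 8) := by ring
        _ ≤ Real.exp (3 * L / 8) * Real.exp (L / 8) := by gcongr
        _ = Real.sqrt n := by rw [hsn, ← Real.exp_add]; ring_nf
    exact le_of_mul_le_mul_right (by linarith) hs0
  -- As many candidates per group as fit into a window of length `1 / x`, across which `exp (-x * Q
  -- * a)` varies by at most a factor `e`.
  set H := ⌊1 / (2 * r * D)⌋₊ with hHdef
  have hH1 : (H : ℝ) ≤ 1 / (2 * r * D) := Nat.floor_le (by positivity)
  have hH2 : 1 / (4 * r * D) ≤ H := by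
    have h1 := Nat.lt_floor_add_one (1 / (2 * r * D))
    have h2 : 1 ≤ 1 / (2 * r * D) := by rw [le_div_iff₀ (by positivity)]; linarith
    have h5 : 0 < H := Nat.floor_pos.2 h2
    have h4 : (1 : ℝ) ≤ H := by exact_mod_cast h5
    have h3 : 1 / (2 * r * D) = 2 * (1 / (4 * r * D)) := by field_simp; norm_num
    linarith
  have hW : (Q : ℝ) * p * (1 + r * H) ≤ 1 / x := by
    rw [le_div_iff₀ hx0]
    have h1 : r * D * H ≤ 1 / 2 := by
      calc r * D * H ≤ r * D * (1 / (2 * r * D)) := by gcongr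
        _ = 1 / 2 := by field_simp
    have h2 : D ≤ 1 / 2 := by
      have : (1 : ℝ) ≤ r := by exact_mod_cast hr
      nlinarith
    calc (Q : ℝ) * p * (1 + r * H) * x = D + r * D * H := by rw [hD]; ring
      _ ≤ 1 := by linarith
  obtain ⟨G, hGd, hG, hGc⟩ := exists_groups (r := r) hp hQ0 hT0 hW
  have hLn : L * Real.sqrt n ≤ n := by
    have h1 : L ≤ Real.sqrt n := by
      rw [hsn]
      have h2 : L ≤ 4 * L ^ 5 := by
        have : 1 ≤ L ^ 4 := one_le_pow₀ (by linarith)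
        nlinarith
      exact h2.trans (hLe.trans (Real.exp_le_exp.2 (by linarith)))
    calc L * Real.sqrt n ≤ Real.sqrt n * Real.sqrt n := by gcongr
      _ = n := Real.mul_self_sqrt hn'.le
  have hxa : ∀ g, ∀ a ∈ G g, L / 2 ≤ x * (Q * a) ∧ x * (Q * a) ≤ x * T + 1 := by
    intro g a ha
    obtain ⟨-, h1, h2⟩ := hG g a ha
    refine ⟨?_, ?_⟩
    · have := mul_le_mul_of_nonneg_left h1.le hx0.le
      linarith
    · calc x * (Q * a) ≤ x * (T + 1 / x) := by gcongr
        _ = _ := by field_simp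
  obtain ⟨ρ, hρdef⟩ : ∃ ρ, ρ = Real.exp (-(x * T + 1)) * ((2 * N) ^ J / 2) := ⟨_, rfl⟩
  have hρ0 : 0 ≤ ρ := by rw [hρdef]; positivity
  have hfam := isBoltzmannFamily_infinitePi x hx0
  have hmain := hfam.ncard_not_hasManyLargeParts_mul_le (n := n) (J := J) (K := J + i) (H := H)
    hp hr hρ0 G hGd (fun g a ha => (hG g a ha).1) ?_ ?_ ?_ (fun g => (hGc g).ge)
  · refine (mul_le_mul_of_nonneg_left (exp_neg_le_exp_mul_prod hn0 hx) (Nat.cast_nonneg _)).trans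
      (hmain.trans ?_)
    have hρH : Real.exp (0.0899 * (L / N)) / (100 * L ^ 5) ≤ ρ * H := by
      have h2J := two_pow_floor_ge (w := L / (4 * N)) (by positivity)
      rw [← hJdef] at h2J
      have hDinv : Real.sqrt n / (8 * L ^ 5 * (p : ℝ) ^ J) ≤ H := by
        refine le_trans ?_ hH2
        rw [div_le_div_iff₀ (by positivity) (by positivity)]
        calc Real.sqrt n * (4 * r * D) = 4 * r * (D * Real.sqrt n) := by ring
          _ ≤ 4 * L * (2 * L ^ 4 * (p : ℝ) ^ J) := by gcongr; linarith
          _ = _ := by ring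
      have h3 : Real.exp (-(x * T + 1)) * Real.sqrt n = Real.exp (-(L / (12 * N))) * Real.exp (-1) := by
        rw [hsn, hxT, ← Real.exp_add, ← Real.exp_add]; ring_nf
      have h4 : Real.exp (0.0899 * (L / N)) ≤
          Real.exp (-(L / (12 * N))) * Real.exp (0.6931 * (L / (4 * N))) := by
        rw [← Real.exp_add]
        refine Real.exp_le_exp.2 ?_
        have h5 : L / (12 * N) = L / N / 12 := by field_simp
        have h6 : L / (4 * N) = L / N / 4 := by field_simp
        have h7 : 0 ≤ L / N := by positivity
        rw [h5, h6]
        linarith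
      have h8 : 1 / 2.75 ≤ Real.exp (-1) := by
        have : Real.exp (-1) * Real.exp 1 = 1 := by rw [← Real.exp_add]; simp
        have h9 := Real.exp_one_lt_d9
        have h10 := Real.exp_pos (-1)
        norm_num
        nlinarith
      calc Real.exp (0.0899 * (L / N)) / (100 * L ^ 5)
          ≤ (Real.exp (-(L / (12 * N))) * Real.exp (0.6931 * (L / (4 * N)))) / (100 * L ^ 5) := by
            gcongr
        _ = Real.exp (-(L / (12 * N))) * (Real.exp (0.6931 * (L / (4 * N))) / 2) / (50 * L ^ 5) := by
            field_simp; norm_num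
        _ ≤ Real.exp (-(L / (12 * N))) * 2 ^ J / (50 * L ^ 5) := by gcongr
        _ ≤ Real.exp (-(L / (12 * N))) * 2 ^ J / (44 * L ^ 5) := by gcongr; norm_num
        _ = Real.exp (-(L / (12 * N))) * (1 / 2.75) * (2 ^ J * (p : ℝ) ^ J / (16 * L ^ 5 * (p : ℝ) ^ J)) := by
            field_simp; norm_num
        _ ≤ Real.exp (-(L / (12 * N))) * Real.exp (-1) *
            ((2 * N) ^ J / (16 * L ^ 5 * (p : ℝ) ^ J)) := by
            rw [← mul_pow]
            gcongr
        _ = ρ * (Real.sqrt n / (8 * L ^ 5 * (p : ℝ) ^ J)) := by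
            rw [← h3, hρdef]; field_simp; norm_num
        _ ≤ ρ * H := by gcongr
    gcongr
    linarith
  · intro g a ha
    have h1 := (hxa g a ha).2
    have h2 : ((a * p ^ J : ℕ) : ℝ) ≤ n := by
      calc ((a * p ^ J : ℕ) : ℝ) ≤ ((Q * a : ℕ) : ℝ) := by
            refine Nat.cast_le.2 ?_
            rw [mul_comm a]
            refine Nat.mul_le_mul_right _ ?_
            rw [hQ, pow_add, ← mul_assoc, mul_right_comm]
            exact Nat.le_mul_of_pos_left _ (Nat.mul_pos (pow_pos hp.pos _) (pow_pos hp.pos _))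
        _ ≤ L * (1 / x) := by
            rw [mul_one_div, le_div_iff₀ hx0]
            push_cast
            rw [hxT] at h1
            linarith
        _ ≤ L * Real.sqrt n := by gcongr
        _ ≤ n := hLn
    exact_mod_cast h2
  · intro g a ha
    rw [← hN, ← hL, ← hTdef]
    refine (hG g a ha).2.1.trans_le (le_of_eq ?_)
    rw [hQ]; push_cast; ring
  · intro g a ha
    obtain ⟨h1, h2⟩ := hxa g a ha
    have e : x * a * (p ^ (r - 1) : ℕ) * (p : ℝ) ^ (J + i) = x * (Q * a) := by
      rw [hQ]; push_cast; ring
    have h3 := hfam.real_good_ge_of_le (p := p) (s := p ^ (r - 1)) (J := J) (i := i) (a := a) (L := L)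
      (N := N) hp.one_lt (pow_pos hp.pos _) (pos_of_not_dvd (hG g a ha).1) hJ0 (by linarith)
      (by linarith) hi2.le hJL (by rw [e]; exact h1) (by rw [e]; rw [hxT] at h2; linarith)
    refine le_trans ?_ h3
    rw [hρdef, e]
    gcongr

/-! ### Absorbing polynomial losses and conclusion -/

theorem four_mul_pow_five_le_exp {L : ℝ} (hL : 2000000 ≤ L) :
    4 * L ^ 5 ≤ Real.exp (3 * L / 8) := by
  refine le_trans ?_ (Real.pow_div_factorial_le_exp (3 * L / 8) (by linarith) 6)
  have h1 : (3 * L / 8) ^ 6 / (Nat.factorial 6 : ℝ) = L ^ 5 * (729 / 188743680 * L) := by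
    norm_num [Nat.factorial]; ring
  rw [h1, mul_comm]
  gcongr
  linarith

/-- The margin `0.0899 - 1 / 20 = 0.0399`, multiplied by `1000 * (log L) ^ 2`, exceeds `39 * log L`,
which pays for every power of `L`. -/
theorem exponent_le {L w : ℝ} (hL : 2000000 ≤ L) (hw : 1000 * Real.log L ^ 2 ≤ w) :
    602 * L + Real.exp (w / 20) ≤ Real.exp (0.0899 * w) / (100 * L ^ 5) := by
  have hL0 : 0 < L := by linarith
  have hu : 1 ≤ Real.log L := by
    rw [Real.le_log_iff_exp_le hL0]
    linarith [Real.exp_one_lt_d9]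
  have h1 : L ^ 39 ≤ Real.exp (0.0399 * w) := by
    have h2 : L ^ 39 = Real.exp (39 * Real.log L) := by
      rw [show (39 : ℝ) = ((39 : ℕ) : ℝ) by norm_num, Real.exp_nat_mul, Real.exp_log hL0]
    rw [h2]
    refine Real.exp_le_exp.2 ?_
    nlinarith
  have hw0 : 0 ≤ w := le_trans (by positivity) hw
  have h3 : 1 ≤ Real.exp (w / 20) := Real.one_le_exp (by positivity)
  have h4 : Real.exp (0.0899 * w) = Real.exp (w / 20) * Real.exp (0.0399 * w) := by
    rw [← Real.exp_add]; ring_nf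
  rw [le_div_iff₀ (by positivity), h4]
  have h5 : (1000 * L) * (100 * L ^ 5) ≤ L ^ 39 := by
    have h6 : 100000 ≤ L ^ 33 := by
      calc (100000 : ℝ) ≤ L := by linarith
        _ ≤ L ^ 33 := le_self_pow₀ (by linarith) (by norm_num)
    calc (1000 * L) * (100 * L ^ 5) = 100000 * L ^ 6 := by ring
      _ ≤ L ^ 33 * L ^ 6 := by gcongr
      _ = _ := by ring
  calc (602 * L + Real.exp (w / 20)) * (100 * L ^ 5)
      ≤ (Real.exp (w / 20) * (1000 * L)) * (100 * L ^ 5) := by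
        gcongr
        nlinarith
    _ = Real.exp (w / 20) * ((1000 * L) * (100 * L ^ 5)) := by ring
    _ ≤ _ := by gcongr; exact h5.trans h1

theorem mainTheorem5 :
    ∃ C : ℝ, 0 < C ∧ ∀ (n p r : ℕ) (hp : p.Prime) (hr : 1 ≤ r), 3 ≤ n →
      (p : ℝ) ^ r ≤ (1 / 1000) * (Real.log n / (Real.log (Real.log n)) ^ 2) →
      (Set.ncard {μ : Nat.Partition n | ¬ HasManyLargeParts p r (fullCombination hp hr μ)} : ℝ)
        ≤ C * ((Fintype.card (Nat.Partition n) : ℝ) *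
            Real.exp (-((n : ℝ) ^ (1 / (20 * (p : ℝ) ^ r))))) := by
  obtain ⟨δ, hδ0, hδ⟩ := Nat.Partition.exists_card_ge
  obtain ⟨L₀, hL₀⟩ : ∃ L₀, L₀ = max 2000000 (Real.log δ⁻¹) := ⟨_, rfl⟩
  -- For `log n < L₀` this constant makes the bound trivial, since `n ^ (1 / (20 * N)) ≤ n ≤ exp
  -- L₀`.
  refine ⟨Real.exp (Real.exp L₀), Real.exp_pos _, ?_⟩
  intro n p r hp hr hn hN
  have hn0 : (0 : ℝ) < n := by exact_mod_cast (by omega : 0 < n)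
  have hn1 : (1 : ℝ) ≤ n := by exact_mod_cast (by omega : 1 ≤ n)
  have hN1 : (1 : ℝ) ≤ (p : ℝ) ^ r := one_le_pow₀ (by exact_mod_cast hp.one_lt.le)
  have hbound := @ncard_not_hasManyLargeParts_mul_exp_le n p r hp hr _ rfl
  generalize hb : (Set.ncard
    {μ : Nat.Partition n | ¬ HasManyLargeParts p r (fullCombination hp hr μ)} : ℝ) = b at *
  generalize (p : ℝ) ^ r = N at *
  obtain ⟨L, hL⟩ : ∃ L, L = Real.log n := ⟨_, rfl⟩
  rw [← hL] at hN hbound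
  have hnL : (n : ℝ) = Real.exp L := by rw [hL, Real.exp_log hn0]
  have hcard0 : (0 : ℝ) ≤ Fintype.card (Nat.Partition n) := Nat.cast_nonneg _
  rcases lt_or_ge L L₀ with hlt | hge
  · have h1 : b ≤ Fintype.card (Nat.Partition n) := by
      rw [← hb, ← Nat.card_eq_fintype_card]
      exact_mod_cast Set.ncard_le_card _
    have h2 : (n : ℝ) ^ (1 / (20 * N)) ≤ Real.exp L₀ := by
      calc (n : ℝ) ^ (1 / (20 * N)) ≤ (n : ℝ) ^ (1 : ℝ) := by
            refine Real.rpow_le_rpow_of_exponent_le hn1 ?_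
            rw [div_le_one (by positivity)]
            linarith
        _ = n := Real.rpow_one _
        _ ≤ Real.exp L₀ := by rw [hnL]; exact Real.exp_le_exp.2 hlt.le
    have h3 : 1 ≤ Real.exp (Real.exp L₀) * Real.exp (-((n : ℝ) ^ (1 / (20 * N)))) := by
      rw [← Real.exp_add]
      exact Real.one_le_exp (by linarith)
    calc b ≤ Fintype.card (Nat.Partition n) * 1 := by linarith
      _ ≤ Fintype.card (Nat.Partition n) *
          (Real.exp (Real.exp L₀) * Real.exp (-((n : ℝ) ^ (1 / (20 * N))))) := by gcongr
      _ = _ := by ring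
  · have hL2 : 2000000 ≤ L := (le_max_left _ _).trans (hL₀ ▸ hge)
    have hLδ : Real.log δ⁻¹ ≤ L := (le_max_right _ _).trans (hL₀ ▸ hge)
    have hL0 : 0 < L := by linarith
    have hu : 1 ≤ Real.log L := by
      rw [Real.le_log_iff_exp_le hL0]
      linarith [Real.exp_one_lt_d9]
    have hu2 : 1 ≤ Real.log L ^ 2 := one_le_pow₀ hu
    have hNu : N * (1000 * Real.log L ^ 2) ≤ L := by
      have : (1 / 1000) * (L / Real.log L ^ 2) = L / (1000 * Real.log L ^ 2) := by
        field_simp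
      rw [this, le_div_iff₀ (by positivity)] at hN
      exact hN
    have hw : 1000 * Real.log L ^ 2 ≤ L / N := by
      rw [le_div_iff₀ (by positivity)]; linarith
    have h1 := hbound (by linarith) (four_mul_pow_five_le_exp hL2) (by nlinarith)
    have h2 := hδ n (by omega)
    have h3 := exponent_le hL2 hw
    have hpow : (n : ℝ) ^ (1 / (20 * N)) = Real.exp (L / N / 20) := by
      rw [Real.rpow_def_of_pos hn0, ← hL]
      congr 1
      field_simp
    rw [hpow]
    generalize Real.exp (0.0899 * (L / N)) / (100 * L ^ 5) = Y at *
    generalize 2 * Real.pi / Real.sqrt 6 * Real.sqrt n = z at *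
    have hz : Real.exp z ≤ Fintype.card (Nat.Partition n) * Real.exp (601 * L) := by
      have h4 : (n : ℝ) ^ 600 = Real.exp (600 * L) := by
        rw [hnL, ← Real.exp_nat_mul]; norm_num
      have h5 : δ⁻¹ ≤ Real.exp L := (Real.log_le_iff_le_exp (by positivity)).1 hLδ
      rw [h4, mul_div_assoc', div_le_iff₀ (Real.exp_pos _)] at h2
      calc Real.exp z = δ⁻¹ * (δ * Real.exp z) := by field_simp
        _ ≤ Real.exp L * (Fintype.card (Nat.Partition n) * Real.exp (600 * L)) := by gcongr
        _ = Fintype.card (Nat.Partition n) * (Real.exp L * Real.exp (600 * L)) := by ring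
        _ = _ := by rw [← Real.exp_add]; ring_nf
    have hLexp : L ≤ Real.exp L := by linarith [Real.add_one_le_exp L]
    have h6 : b * Real.exp (-z) ≤ Real.exp L * Real.exp (-Y) := h1.trans (by gcongr)
    -- The loss `602 * L` collects `600` from the model, one from `δ⁻¹ ≤ exp L` and one from the
    -- prefactor `L ≤ exp L`.
    calc b = b * Real.exp (-z) * Real.exp z := by
          rw [mul_assoc, ← Real.exp_add]; simp
      _ ≤ Real.exp L * Real.exp (-Y) * (Fintype.card (Nat.Partition n) * Real.exp (601 * L)) :=
          mul_le_mul h6 hz (Real.exp_pos _).le (by positivity)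
      _ = Fintype.card (Nat.Partition n) * Real.exp (602 * L + -Y) := by
          rw [show 602 * L + -Y = L + -Y + 601 * L by ring, Real.exp_add, Real.exp_add]; ring
      _ ≤ 1 * (Fintype.card (Nat.Partition n) * Real.exp (-Real.exp (L / N / 20))) := by
          rw [one_mul]
          gcongr
          linarith
      _ ≤ _ := by
          gcongr
          exact Real.one_le_exp (Real.exp_pos _).le
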